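/- Let $\mathcal G$ be a complex Lie algebra (of arbitrary dimension), $\mathcal H\subseteq\mathcal G$ a subalgebra and $(\cdot,\cdot)$ a bilinear form on $\mathcal G$. For $\alpha\in\mathcal H^\star$ put $\mathcal G_\alpha=\{x\in\mathcal G\mid [h,x]=\alpha(h)x\text{ for all }h\in\mathcal H\}$ and let $R=\{\alpha\in\mathcal H^\star\mid\mathcal G_\alpha\neq\{0\}\}$. The triple $(\mathcal G,(\cdot,\cdot),\mathcal H)$ is a *generalized reductive Lie algebra* (GRLA) if - (GR1) the form is symmetric, nondegenerate and invariant; - (GR2) $\mathcal H$ is a nontrivial finite dimensional abelian self-centralizing subalgebra and $\mathrm{ad}(h)$ is diagonalizable for every $h\in\mathcal H$; - (GR3) for $\alpha\in R^\times$ and $x\in\mathcal G_\alpha$, $\mathrm{ad}(x)$ is locally nilpotent on $\mathcal G$; - (GR4) $R$ is a discrete subset of $\mathcal H^\star$; - (GR5) $R^\times\neq\emptyset$. Here $R^\times=\{\alpha\in R\mid(\alpha,\alpha)\neq0\}$, where $(\alpha,\alpha):=(t_\alpha,t_\alpha)$ and $t_\alpha\in\mathcal H$ is the unique element with $(t_\alpha,h)=\alpha(h)$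 for all $h\in\mathcal H$. The *core* $\mathcal G_c$ is the subalgebra of $\mathcal G$ generated by the root spaces $\mathcal G_\alpha$, $\alpha\in R^\times$. $\mathcal Z(\cdot)$ denotes the center. Let $\dot R$ be an irreducible (crystallographic, possibly non-reduced) finite root system, with $0\in\dot R$ by convention, and $\dot R^\times=\dot R\setminus\{0\}$; let $\Lambda$ be a free abelian group of finite rank. A complex Lie algebra $\mathcal L$ is a *Lie torus of type* $(\dot R,\Lambda)$ if - (LT1) $\mathcal L=\bigoplus_{\dot\alpha\in\langle\dot R\rangle,\lambda\in\Lambda}\mathcal L_{\dot\alpha}^\lambda$ with $[\mathcal L_{\dot\alpha}^\lambda,\mathcal L_{\dot\beta}^\mu]\subseteq\mathcal L_{\dot\alpha+\dot\beta}^{\lambda+\mu}$, and $\mathcal L_{\dot\alpha}^\lambda=\{0\}$ if $\dot\alpha\notin\dot R$; - (LT2) for $\dot\alpha\in\dot R^\times$ and $\lambda\in\Lambda$: (i) $\dim\mathcal L_{\dot\alpha}^\lambda\le1$, and $\dim\mathcal L_{\dot\alpha}^0=1$ if $\frac12\dot\alpha\notin\dot R$; (ii) if $\dim\mathcal L_{\dot\alpha}^\lambda=1$,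 there are $e\in\mathcal L_{\dot\alpha}^\lambda$ and $f\in\mathcal L_{-\dot\alpha}^{-\lambda}$ such that $[[e,f],x]=(\dot\beta,\dot\alpha^\vee)x$ for all $\dot\beta\in\dot R$, $\mu\in\Lambda$, $x\in\mathcal L_{\dot\beta}^\mu$, where $(\dot\beta,\dot\alpha^\vee)$ is the Cartan integer; - (LT3) $\mathcal L_0^\lambda=\sum_{\dot\alpha\in\dot R^\times,\mu\in\Lambda}[\mathcal L_{\dot\alpha}^\mu,\mathcal L_{-\dot\alpha}^{\lambda-\mu}]$ for all $\lambda\in\Lambda$; - (LT4) $\Lambda$ is generated by the set of all $\lambda\in\Lambda$ with $\mathcal L_{\dot\alpha}^\lambda\neq\{0\}$ for some $\dot\alpha\in\dot R$. **Corollary.** For every GRLA $(\mathcal G,(\cdot,\cdot),\mathcal H)$, the core modulo its center $\mathcal G_c/\mathcal Z(\mathcal G_c)$ is a direct sum of finitely many (and at least one) ideals, each of which is a centerless Lie torus, that is, has zero center and is a Lie torus of some type $(\dot R,\Lambda)$. -/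

import Mathlib

namespace GenRed

/-! ### Generalized reductive Lie algebras -/

section GRLA

variable {G : Type*} [LieRing G] [LieAlgebra ℂ G]

/-- The space of all `x` with `⁅h, x⁆ = α h • x` for all `h ∈ H`. -/
def rootSpace (H : LieSubalgebra ℂ G) (α : Module.Dual ℂ H) : Submodule ℂ G where
  carrier := {x | ∀ h : H, ⁅(h : G), x⁆ = α h • x}
  zero_mem' := fun h => by simp
  add_mem' := fun {x y} hx hy h => by rw [lie_add, hx h, hy h, smul_add]
  smul_mem' := fun c x hx h => by rw [lie_smul, hx h, smul_comm]

/-- The root system `R` of `(G, H)`; note that `0 ∈ R` as soon as `H` is nonzero and abelian. -/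
def roots (H : LieSubalgebra ℂ G) : Set (Module.Dual ℂ H) :=
  {α | rootSpace H α ≠ ⊥}

/-- The set `R^×` of non-isotropic roots. The form is transferred to the dual of `H` by
`(α, α) = (t, t)`, where `t ∈ H` is the element representing `α` through the form
(it exists and is unique when the form is nondegenerate on `H`, as it is under GR1 and GR2). -/
def nonisotropicRoots (form : LinearMap.BilinForm ℂ G) (H : LieSubalgebra ℂ G) :
    Set (Module.Dual ℂ H) :=
  {α | α ∈ roots H ∧ ∃ t : H, (∀ h : H, form (t : G) (h : G) = α h) ∧ form (t : G) (t : G) ≠ 0}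

/-- The triple `(G, form, H)` is a generalized reductive Lie algebra. -/
structure IsGRLA (form : LinearMap.BilinForm ℂ G) (H : LieSubalgebra ℂ G) : Prop where
  /-- GR1: the form is symmetric, nondegenerate and invariant. -/
  symm : ∀ x y : G, form x y = form y x
  nondegenerate : ∀ x : G, (∀ y : G, form x y = 0) → x = 0
  invariant : ∀ x y z : G, form ⁅x, y⁆ z = form x ⁅y, z⁆
  /-- GR2: `H` is a nontrivial finite dimensional abelian self-centralizing subalgebra all of
  whose elements are ad-diagonalizable. -/
  nontrivial : Nontrivial H
  finiteDimensional : FiniteDimensional ℂ H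
  abelian : ∀ x ∈ H, ∀ y ∈ H, ⁅x, y⁆ = 0
  self_centralizing : ∀ x : G, (∀ h ∈ H, ⁅h, x⁆ = 0) → x ∈ H
  diagonalizable : ∀ h ∈ H, ⨆ c : ℂ, (LieAlgebra.ad ℂ G h).eigenspace c = ⊤
  /-- GR3: root vectors of non-isotropic roots are ad-locally nilpotent. -/
  locally_nilpotent : ∀ α ∈ nonisotropicRoots form H, ∀ x ∈ rootSpace H α, ∀ y : G,
    ∃ n : ℕ, ((LieAlgebra.ad ℂ G x) ^ n) y = 0
  /-- GR4: the roots form a discrete subset of the dual of `H`, in its canonical topology as a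
  finite dimensional complex vector space. -/
  discrete : @IsDiscrete _ (moduleTopology ℂ (Module.Dual ℂ H)) (roots H)
  /-- GR5: there are non-isotropic roots. -/
  nonempty : (nonisotropicRoots form H).Nonempty

/-- The core: the subalgebra generated by the root spaces of the non-isotropic roots. -/
def core (form : LinearMap.BilinForm ℂ G) (H : LieSubalgebra ℂ G) : LieSubalgebra ℂ G :=
  LieSubalgebra.lieSpan ℂ G {x | ∃ α ∈ nonisotropicRoots form H, x ∈ rootSpace H α}

/-- The core modulo its center. -/
abbrev CoreModCenter (form : LinearMap.BilinForm ℂ G) (H : LieSubalgebra ℂ G) :=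
  core form H ⧸ LieAlgebra.center ℂ (core form H)

end GRLA

/-! ### Lie tori -/

section LieTorus

variable {ι M N : Type*} [AddCommGroup M] [Module ℝ M] [AddCommGroup N] [Module ℝ N]
  {Λ : Type*} [AddCommGroup Λ] {L : Type*} [LieRing L] [LieAlgebra ℂ L]

/-- The axioms LT1 - LT4 for a family `grade q l` of subspaces of `L`, indexed by `q` in the root
lattice of the root system `P` and by `l ∈ Λ`. The nonzero roots are the `P.root i`, and
`P.rootSpanMem ℤ i` is `P.root i` as an element of the root lattice. -/
structure IsLieTorusGrading (P : RootPairing ι ℝ M N)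
    (grade : P.rootSpan ℤ → Λ → Submodule ℂ L) : Prop where
  /-- LT1: this is a grading of the Lie algebra `L`, supported on the roots and `0`. -/
  isInternal : open Classical in
    DirectSum.IsInternal (fun p : P.rootSpan ℤ × Λ => grade p.1 p.2)
  lie_mem : ∀ (p q : P.rootSpan ℤ) (l m : Λ), ∀ x ∈ grade p l, ∀ y ∈ grade q m,
    ⁅x, y⁆ ∈ grade (p + q) (l + m)
  support : ∀ (q : P.rootSpan ℤ) (l : Λ), q ≠ 0 → (∀ i, q ≠ P.rootSpanMem ℤ i) → grade q l = ⊥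
  /-- LT2 (i). -/
  rank_le_one : ∀ (i : ι) (l : Λ), Module.rank ℂ (grade (P.rootSpanMem ℤ i) l) ≤ 1
  rank_eq_one : ∀ i : ι, (∀ j, P.root i ≠ (2 : ℝ) • P.root j) →
    Module.rank ℂ (grade (P.rootSpanMem ℤ i) 0) = 1
  /-- LT2 (ii): `⁅e, f⁆` acts on the component of degree `(q, m)` as the scalar
  `(q, α^∨)`, which is a Cartan integer when `q` is a root, and `0` when `q = 0`. -/
  exists_sl2 : ∀ (i : ι) (l : Λ), Module.rank ℂ (grade (P.rootSpanMem ℤ i) l) = 1 →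
    ∃ e ∈ grade (P.rootSpanMem ℤ i) l, ∃ f ∈ grade (-P.rootSpanMem ℤ i) (-l),
      ∀ (q : P.rootSpan ℤ) (m : Λ), ∀ x ∈ grade q m,
        ⁅⁅e, f⁆, x⁆ = ((P.coroot' i (q : M) : ℝ) : ℂ) • x
  /-- LT3. -/
  grade_zero : ∀ l : Λ, grade 0 l = Submodule.span ℂ
    {z | ∃ (i : ι) (m : Λ), ∃ x ∈ grade (P.rootSpanMem ℤ i) m,
      ∃ y ∈ grade (-P.rootSpanMem ℤ i) (l - m), ⁅x, y⁆ = z}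
  /-- LT4. -/
  closure_eq_top : AddSubgroup.closure {l : Λ | ∃ q : P.rootSpan ℤ, grade q l ≠ ⊥} = ⊤

end LieTorus

/-- `L` is a Lie torus: for some irreducible (crystallographic, possibly non-reduced) finite root
system `P` and some free abelian group `Λ` of finite rank, `L` is a Lie torus of type `(P, Λ)`. -/
def IsLieTorus (L : Type*) [LieRing L] [LieAlgebra ℂ L] : Prop :=
  ∃ (ι M N : Type) (_ : AddCommGroup M) (_ : Module ℝ M) (_ : AddCommGroup N) (_ : Module ℝ N)
    (P : RootPairing ι ℝ M N) (Λ : Type) (_ : AddCommGroup Λ)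
    (grade : P.rootSpan ℤ → Λ → Submodule ℂ L),
    Finite ι ∧ P.IsRootSystem ∧ P.IsCrystallographic ∧ P.IsIrreducible ∧
    Module.Free ℤ Λ ∧ Module.Finite ℤ Λ ∧ IsLieTorusGrading P grade

/-- The Lie torus `L` is centerless. -/
def IsCenterlessLieTorus (L : Type*) [LieRing L] [LieAlgebra ℂ L] : Prop :=
  IsLieTorus L ∧ LieAlgebra.center ℂ L = ⊥

end GenRed

/-!
The proof has three layers.

*Roots.* The algebra `G` is the direct sum of its root spaces, the form pairs `G_α` with `G_{-α}`,
and for a non-isotropic root `α` there are root vectors in `G_α` and `G_{-α}` which form an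
`sl₂`-triple with the coroot of `α`. Local nilpotency replaces finite-dimensionality in the
representation theory of `sl₂`, and gives integral pairings, reflections, root strings and
one-dimensional root spaces. If an isotropic root `δ` were not orthogonal to a non-isotropic `α`,
then `α + m δ` would be a root for infinitely many `m`, and the pairings with these roots could not
all be integers. So isotropic roots are orthogonal to the non-isotropic ones. The same kind of
integrality argument along root strings bounds all Cartan integers by `4`, without showing first
that the form is positive semidefinite (`IsGRLA.abs_le_four`).

*Root systems.* The non-isotropic roots split into finitely many mutually orthogonal connected
components. The map sending a root of a component to its pairings with finitely many coroots has a
finite image, as these are bounded integers, and this image is an irreducible finite root system `P`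
(`IsConnectedRootSet.exists_rootPairing`). A base of its reduced subsystem of indivisible roots is a
basis of the root lattice, so its elements can be lifted to roots of the component, which gives a
section of the projection. Every root is then a pair of an element of `P` and a shift in the kernel
of the projection. The shifts of a root are stable under translation by twice the group which they
generate, and hence discreteness of the roots makes the group `Λ` of all shifts finitely generated
(`IsConnectedRootSet.exists_type`). This is where the degrees `(P, Λ)` come from.

*Lie algebras.* For each component, its root spaces together with their brackets are closed under
brackets; different components commute, and the core is the sum of all these pieces. The core is
perfect, so its quotient by the center is centerless, and hence the sum of the images of the
components is direct. Homogeneous components of central elements of the core are central, so the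
images are still graded by the degrees `(P, Λ)`, and the Lie torus axioms can be read off
(`IsGRLA.isLieTorusGrading`).
-/

namespace GenRed

/-! ### Simultaneous diagonalization in arbitrary dimension -/

section Diagonalization

variable {K V ι : Type*} [Field K] [AddCommGroup V] [Module K V]

/-- A subspace cut out by eigenvalue equations for operators commuting with a diagonalizable `f`
is the sum of its intersections with the eigenspaces of `f`. -/
lemma exists_sum_eigenvectors {f : Module.End K V} (hf : ⨆ c, f.eigenspace c = ⊤) (x : V) :
    ∃ v : K →₀ V, (∀ c, f (v c) = c • v c) ∧ (v.sum fun _ y => y) = x ∧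
      ∀ (g : Module.End K V) (a : K), Commute f g → g x = a • x → ∀ c, g (v c) = a • v c := by
  obtain ⟨v, hv, hvx⟩ := (Submodule.mem_iSup_iff_exists_finsupp _ x).1 (hf ▸ Submodule.mem_top)
  have hv' : ∀ c, f (v c) = c • v c := fun c => Module.End.mem_eigenspace_iff.1 (hv c)
  refine ⟨v, hv', hvx, fun g a hfg hx c => ?_⟩
  have hind := Module.End.eigenspaces_iSupIndep f
  rw [iSupIndep_iff_finsetSum_eq_zero_imp_eq_zero] at hind
  by_cases hc : c ∈ v.support
  · have := hind v.support (fun c => g (v c) - a • v c) (fun c => ?_) ?_ c hc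
    · exact sub_eq_zero.1 this
    · intro _
      rw [Module.End.mem_eigenspace_iff, map_sub, map_smul, hv', smul_sub, smul_comm c a]
      congr 1
      have := LinearMap.congr_fun hfg.eq (v c)
      simp only [Module.End.mul_apply, hv', map_smul] at this
      exact this
    · rw [Finset.sum_sub_distrib, ← map_sum, ← Finset.smul_sum]
      have : ∑ i ∈ v.support, v i = x := hvx
      rw [this, hx, sub_self]
  · simp [Finsupp.notMem_support_iff.1 hc]

lemma iSup_iInf_eigenspace_eq_top (f : ι → Module.End K V) (hcomm : ∀ i j, Commute (f i) (f j))
    (hf : ∀ i, ⨆ c, (f i).eigenspace c = ⊤) (s : Finset ι) (x : V) :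
    x ∈ ⨆ χ : ι → K, ⨅ i ∈ s, (f i).eigenspace (χ i) := by
  classical
  induction s using Finset.induction_on with
  | empty => simp
  | insert a s ha ih =>
    refine Submodule.iSup_induction _ (motive := fun x => x ∈ ⨆ χ : ι → K,
      ⨅ i ∈ insert a s, (f i).eigenspace (χ i)) ih ?_ (zero_mem _) (fun _ _ => add_mem)
    intro χ x hx
    obtain ⟨v, hv, rfl, hg⟩ := exists_sum_eigenvectors (hf a) x
    refine Submodule.sum_mem _ fun c _ => ?_
    refine Submodule.mem_iSup_of_mem (Function.update χ a c) ?_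
    simp only [Submodule.mem_iInf, Module.End.mem_eigenspace_iff] at hx ⊢
    intro i hi
    rcases Finset.mem_insert.1 hi with rfl | hi
    · simpa using hv c
    · have hne : i ≠ a := fun h => ha (h ▸ hi)
      rw [Function.update_of_ne hne]
      exact hg (f i) (χ i) (hcomm a i) (hx i hi) c

end Diagonalization

/-! ### Root spaces and the form -/

section RootSpaces

variable {G : Type*} [LieRing G] [LieAlgebra ℂ G] {form : LinearMap.BilinForm ℂ G}
  {H : LieSubalgebra ℂ G} {α β : Module.Dual ℂ H} {x y : G}

lemma lie_mem_rootSpace (hx : x ∈ rootSpace H α) (hy : y ∈ rootSpace H β) :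
    ⁅x, y⁆ ∈ rootSpace H (α + β) := fun h => by
  rw [leibniz_lie, hx h, hy h, smul_lie, lie_smul, LinearMap.add_apply, add_smul]

lemma ad_pow_mem_rootSpace (hx : x ∈ rootSpace H α) (hy : y ∈ rootSpace H β) (n : ℕ) :
    ((LieAlgebra.ad ℂ G x) ^ n) y ∈ rootSpace H (β + (n : ℤ) • α) := by
  induction n with
  | zero => simpa using hy
  | succ n ih =>
    rw [pow_succ', Module.End.mul_apply, LieAlgebra.ad_apply]
    have := lie_mem_rootSpace hx ih
    rwa [show α + (β + (n : ℤ) • α) = β + ((n + 1 : ℕ) : ℤ) • α by push_cast; module] at this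

lemma mem_roots_of_mem (hx : x ∈ rootSpace H α) (h0 : x ≠ 0) : α ∈ roots H :=
  fun h => h0 ((Submodule.mem_bot ℂ).1 (h ▸ hx))

lemma exists_of_mem_roots (h : α ∈ roots H) : ∃ x ∈ rootSpace H α, x ≠ 0 :=
  Submodule.exists_mem_ne_zero_of_ne_bot h

namespace IsGRLA

variable (hG : IsGRLA form H)
include hG

lemma commute_ad (h k : H) :
    Commute (LieAlgebra.ad ℂ G (h : G)) (LieAlgebra.ad ℂ G (k : G)) := by
  refine LinearMap.ext fun x => ?_
  simp only [Module.End.mul_apply, LieAlgebra.ad_apply]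
  rw [leibniz_lie, hG.abelian _ h.2 _ k.2, zero_lie, zero_add]

lemma iSupIndep_rootSpace : iSupIndep (rootSpace H) := by
  have h1 := Module.End.independent_iInf_maxGenEigenspace_of_forall_mapsTo
    (fun h : H => LieAlgebra.ad ℂ G (h : G)) (fun i j c =>
      Module.End.mapsTo_maxGenEigenspace_of_comm (hG.commute_ad j i) c)
  refine (h1.comp (f := fun α : Module.Dual ℂ H => (α : H → ℂ)) DFunLike.coe_injective).mono ?_
  refine fun α => le_iInf fun h x hx => ?_
  have hx' : x ∈ (LieAlgebra.ad ℂ G (h : G)).eigenspace (α h) :=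
    Module.End.mem_eigenspace_iff.2 (hx h)
  exact ((LieAlgebra.ad ℂ G (h : G)).genEigenspace (α h)).monotone le_top hx'

lemma iSup_rootSpace (x : G) : x ∈ ⨆ α, rootSpace H α := by
  have := hG.finiteDimensional
  let b := Module.finBasis ℂ H
  have hx := iSup_iInf_eigenspace_eq_top (fun i => LieAlgebra.ad ℂ G (b i : G))
    (fun i j => hG.commute_ad (b i) (b j))
    (fun i => hG.diagonalizable _ (b i).2) Finset.univ x
  refine (iSup_le fun χ => ?_ : _ ≤ ⨆ α, rootSpace H α) hx
  refine le_trans ?_ (le_iSup _ (b.constr ℂ χ))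
  intro x hx h
  simp only [Submodule.mem_iInf, Module.End.mem_eigenspace_iff, Finset.mem_univ, forall_true_left,
    LieAlgebra.ad_apply] at hx
  rw [← b.sum_repr h, AddSubmonoidClass.coe_finsetSum, sum_lie, map_sum, Finset.sum_smul]
  refine Finset.sum_congr rfl fun i _ => ?_
  rw [SetLike.val_smul, smul_lie, hx, map_smul, b.constr_basis, smul_eq_mul, mul_smul]

lemma rootSpace_induction {p : G → Prop} (mem : ∀ α, ∀ x ∈ rootSpace H α, p x) (zero : p 0)
    (add : ∀ x y, p x → p y → p (x + y)) (x : G) : p x :=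
  Submodule.iSup_induction _ (motive := p) (hG.iSup_rootSpace x) mem zero add

lemma mem_rootSpace_zero : x ∈ rootSpace H (0 : Module.Dual ℂ H) ↔ x ∈ H := by
  refine ⟨fun h => hG.self_centralizing x fun z hz => by simpa using h ⟨z, hz⟩, fun h z => ?_⟩
  simpa using hG.abelian _ z.2 _ h

lemma form_eq_zero (hx : x ∈ rootSpace H α) (hy : y ∈ rootSpace H β) (h : α + β ≠ 0) :
    form x y = 0 := by
  obtain ⟨z, hz⟩ : ∃ z : H, (α + β) z ≠ 0 := by
    by_contra! hc; exact h (LinearMap.ext hc)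
  have h1 : form ⁅x, (z : G)⁆ y = form x ⁅(z : G), y⁆ := hG.invariant _ _ _
  rw [← lie_skew, hx z, hy z] at h1
  simp only [map_neg, map_smul, LinearMap.neg_apply, LinearMap.smul_apply, smul_eq_mul] at h1
  have : (α + β) z * form x y = 0 := by rw [LinearMap.add_apply]; linear_combination -h1
  exact (mul_eq_zero.1 this).resolve_left hz

lemma eq_zero_of_form_eq_zero (hx : x ∈ rootSpace H α)
    (h : ∀ y ∈ rootSpace H (-α), form x y = 0) : x = 0 := by
  refine hG.nondegenerate x fun y => ?_
  refine hG.rootSpace_induction (p := fun y => form x y = 0) ?_ (by simp)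
    (fun y z hy hz => by rw [map_add, hy, hz, add_zero]) y
  intro β y hy
  by_cases hβ : α + β = 0
  · exact h y (by rwa [neg_eq_of_add_eq_zero_right hβ])
  · exact hG.form_eq_zero hx hy hβ

lemma exists_form_eq_one (hx : x ∈ rootSpace H α) (h0 : x ≠ 0) :
    ∃ y ∈ rootSpace H (-α), form x y = 1 := by
  by_contra! hc
  refine h0 (hG.eq_zero_of_form_eq_zero hx fun y hy => ?_)
  by_contra hne
  exact hc ((form x y)⁻¹ • y) (Submodule.smul_mem _ _ hy) (by simp [hne])

lemma neg_mem_roots (h : α ∈ roots H) : -α ∈ roots H := by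
  obtain ⟨x, hx, h0⟩ := exists_of_mem_roots h
  obtain ⟨y, hy, hxy⟩ := hG.exists_form_eq_one hx h0
  exact mem_roots_of_mem hy (by rintro rfl; simp at hxy)

lemma form_restrict_injective :
    Function.Injective (form.domRestrict₁₂ H.toSubmodule H.toSubmodule) := by
  rw [injective_iff_map_eq_zero]
  intro h hh
  refine Subtype.ext (hG.eq_zero_of_form_eq_zero (hG.mem_rootSpace_zero.2 h.2) fun y hy => ?_)
  rw [neg_zero, hG.mem_rootSpace_zero] at hy
  exact LinearMap.congr_fun hh ⟨y, hy⟩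

/-- The identification of `H` with its dual through the form. -/
noncomputable def equivDual : H ≃ₗ[ℂ] Module.Dual ℂ H :=
  haveI := hG.finiteDimensional
  LinearEquiv.ofInjectiveOfFinrankEq (V := H) (V' := Module.Dual ℂ H)
    (form.domRestrict₁₂ H.toSubmodule H.toSubmodule) hG.form_restrict_injective
    Subspace.dual_finrank_eq.symm

/-- The element of `H` representing `α` through the form. -/
noncomputable def rep : Module.Dual ℂ H →ₗ[ℂ] H := hG.equivDual.symm.toLinearMap

lemma form_rep (α : Module.Dual ℂ H) (h : H) : form (hG.rep α : G) (h : G) = α h := by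
  have : hG.equivDual (hG.rep α) = α := hG.equivDual.apply_symm_apply α
  exact LinearMap.congr_fun this h

lemma rep_unique {t : H} (ht : ∀ h : H, form (t : G) (h : G) = α h) : t = hG.rep α := by
  apply hG.form_restrict_injective
  ext h
  exact (ht h).trans (hG.form_rep α h).symm

/-- The form on the dual of `H` transferred from `H`. -/
noncomputable def ip (α β : Module.Dual ℂ H) : ℂ := β (hG.rep α)

lemma ip_comm (α β : Module.Dual ℂ H) : hG.ip α β = hG.ip β α := by
  rw [ip, ip, ← hG.form_rep β, ← hG.form_rep α, hG.symm]

lemma apply_rep (α β : Module.Dual ℂ H) : β (hG.rep α) = hG.ip α β := rfl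

@[simp] lemma ip_add_right (α β γ : Module.Dual ℂ H) :
    hG.ip α (β + γ) = hG.ip α β + hG.ip α γ := rfl
@[simp] lemma ip_sub_right (α β γ : Module.Dual ℂ H) :
    hG.ip α (β - γ) = hG.ip α β - hG.ip α γ := rfl
@[simp] lemma ip_neg_right (α β : Module.Dual ℂ H) : hG.ip α (-β) = -hG.ip α β := rfl
@[simp] lemma ip_smul_right (α β : Module.Dual ℂ H) (c : ℂ) :
    hG.ip α (c • β) = c * hG.ip α β := rfl
@[simp] lemma ip_zsmul_right (α β : Module.Dual ℂ H) (c : ℤ) :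
    hG.ip α (c • β) = c * hG.ip α β := by
  rw [← Int.cast_smul_eq_zsmul ℂ, ip_smul_right]
@[simp] lemma ip_add_left (α β γ : Module.Dual ℂ H) :
    hG.ip (β + γ) α = hG.ip β α + hG.ip γ α := by simp [ip]
@[simp] lemma ip_sub_left (α β γ : Module.Dual ℂ H) :
    hG.ip (β - γ) α = hG.ip β α - hG.ip γ α := by simp [ip]
@[simp] lemma ip_neg_left (α β : Module.Dual ℂ H) : hG.ip (-β) α = -hG.ip β α := by simp [ip]
@[simp] lemma ip_smul_left (α β : Module.Dual ℂ H) (c : ℂ) :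
    hG.ip (c • β) α = c * hG.ip β α := by simp [ip]
@[simp] lemma ip_zsmul_left (α β : Module.Dual ℂ H) (c : ℤ) :
    hG.ip (c • β) α = c * hG.ip β α := by
  rw [← Int.cast_smul_eq_zsmul ℂ, ip_smul_left]

lemma mem_nonisotropicRoots :
    α ∈ nonisotropicRoots form H ↔ α ∈ roots H ∧ hG.ip α α ≠ 0 := by
  refine and_congr_right fun _ => ⟨?_, fun h => ⟨hG.rep α, hG.form_rep α, ?_⟩⟩
  · rintro ⟨t, ht, h⟩
    rwa [ht, hG.rep_unique ht] at h
  · rwa [hG.form_rep]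

lemma neg_mem_nonisotropicRoots (h : α ∈ nonisotropicRoots form H) :
    -α ∈ nonisotropicRoots form H := by
  rw [hG.mem_nonisotropicRoots] at h ⊢
  exact ⟨hG.neg_mem_roots h.1, by simpa using h.2⟩

lemma lie_eq_smul_rep (hx : x ∈ rootSpace H α) (hy : y ∈ rootSpace H (-α)) :
    ⁅x, y⁆ = form x y • (hG.rep α : G) := by
  have hxy : ⁅x, y⁆ ∈ H := by
    have := lie_mem_rootSpace hx hy
    rwa [add_neg_cancel, hG.mem_rootSpace_zero] at this
  have : (⟨⁅x, y⁆, hxy⟩ : H) = form x y • hG.rep α := by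
    rw [← map_smul]
    refine hG.rep_unique fun h => ?_
    change form ⁅x, y⁆ h = _
    rw [hG.invariant, ← lie_skew, hy h]
    simp [mul_comm]
  exact congrArg Subtype.val this

/-- The coroot `2 t_α / (α, α)`. -/
noncomputable def coroot (α : Module.Dual ℂ H) : H := (2 / hG.ip α α) • hG.rep α

lemma apply_coroot (α β : Module.Dual ℂ H) :
    β (hG.coroot α) = 2 * hG.ip α β / hG.ip α α := by
  rw [coroot, map_smul, apply_rep, smul_eq_mul]; ring

lemma coroot_neg (α : Module.Dual ℂ H) : hG.coroot (-α) = -hG.coroot α := by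
  simp [coroot]

lemma apply_coroot_self (h : α ∈ nonisotropicRoots form H) : α (hG.coroot α) = 2 := by
  have := (hG.mem_nonisotropicRoots.1 h).2
  rw [apply_coroot]; field_simp

lemma lie_coroot (hy : y ∈ rootSpace H β) (α : Module.Dual ℂ H) :
    ⁅(hG.coroot α : G), y⁆ = β (hG.coroot α) • y := hy _

lemma exists_isSl2Triple (h : α ∈ nonisotropicRoots form H) :
    ∃ e ∈ rootSpace H α, ∃ f ∈ rootSpace H (-α), IsSl2Triple (hG.coroot α : G) e f := by
  have h2 := hG.apply_coroot_self h
  obtain ⟨hr, hi⟩ := hG.mem_nonisotropicRoots.1 h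
  obtain ⟨e, he, h0⟩ := exists_of_mem_roots hr
  obtain ⟨f, hf, hef⟩ := hG.exists_form_eq_one he h0
  refine ⟨e, he, (2 / hG.ip α α) • f, Submodule.smul_mem _ _ hf, ?_, ?_, ?_, ?_⟩
  · intro hc
    have : hG.coroot α = 0 := Subtype.ext hc
    rw [this, map_zero] at h2
    exact two_ne_zero h2.symm
  · rw [lie_smul, hG.lie_eq_smul_rep he hf, hef, one_smul, coroot]; rfl
  · rw [hG.lie_coroot he, h2, two_smul, two_smul]
  · rw [hG.lie_coroot (Submodule.smul_mem _ _ hf), LinearMap.neg_apply, h2, neg_smul, two_smul,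
      two_smul]

end IsGRLA

end RootSpaces

/-! ### Root strings -/

section Sl2

variable {L : Type*} [LieRing L] [LieAlgebra ℂ L] {e f h w : L} {μ : ℂ}

/-- In arbitrary dimension, local nilpotency of `f` at a primitive vector is enough for its weight
to be a natural number `N`, with `f ^ i w ≠ 0` for `i ≤ N`. -/
lemma exists_nat_of_primitive (t : IsSl2Triple h e f) (P : t.HasPrimitiveVectorWith w μ)
    (hf : ∃ n : ℕ, ((LieAlgebra.ad ℂ L f) ^ n) w = 0) :
    ∃ N : ℕ, μ = N ∧ ∀ i ≤ N, ((LieAlgebra.ad ℂ L f) ^ i) w ≠ 0 := by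
  classical
  have h0 : Nat.find hf ≠ 0 := fun hc => P.ne_zero (by simpa [hc] using Nat.find_spec hf)
  obtain ⟨N, hN⟩ := Nat.exists_eq_succ_of_ne_zero h0
  refine ⟨N, ?_, fun i hi => Nat.find_min hf (by omega)⟩
  have h1 := P.lie_e_pow_succ_toEnd_f N
  have h2 : ((LieAlgebra.ad ℂ L f) ^ (N + 1)) w = 0 := by
    have := Nat.find_spec hf
    rwa [hN] at this
  have h3 : ((LieAlgebra.ad ℂ L f) ^ N) w ≠ 0 := Nat.find_min hf (by omega)
  change ⁅e, ((LieAlgebra.ad ℂ L f) ^ (N + 1)) w⁆ =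
    ((N + 1 : ℂ) * (μ - N)) • ((LieAlgebra.ad ℂ L f) ^ N) w at h1
  rw [h2, lie_zero, eq_comm, smul_eq_zero_iff_left h3] at h1
  rcases mul_eq_zero.1 h1 with h | h
  · exact absurd h (by exact_mod_cast N.succ_ne_zero)
  · exact sub_eq_zero.1 h

/-- For any operator, a nonzero vector has a last nonzero iterate, if some iterate vanishes. -/
lemma exists_last_iterate {V : Type*} [AddCommGroup V] [Module ℂ V] (T : Module.End ℂ V) {v : V}
    (hv : v ≠ 0) (hn : ∃ n : ℕ, (T ^ n) v = 0) : ∃ k : ℕ, (T ^ k) v ≠ 0 ∧ T ((T ^ k) v) = 0 := by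
  classical
  have h0 : Nat.find hn ≠ 0 := fun hc => hv (by simpa [hc] using Nat.find_spec hn)
  obtain ⟨N, hN⟩ := Nat.exists_eq_succ_of_ne_zero h0
  refine ⟨N, Nat.find_min hn (by omega), ?_⟩
  rw [← Module.End.mul_apply, ← pow_succ']
  have := Nat.find_spec hn
  rwa [hN] at this

end Sl2

namespace IsGRLA

variable {G : Type*} [LieRing G] [LieAlgebra ℂ G] {form : LinearMap.BilinForm ℂ G}
  {H : LieSubalgebra ℂ G} {α β δ : Module.Dual ℂ H} {x y : G} (hG : IsGRLA form H)
include hG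

/-- Integrality and the root string property. -/
lemma exists_int_string (hα : α ∈ nonisotropicRoots form H) (hβ : β ∈ roots H) :
    ∃ p : ℤ, β (hG.coroot α) = p ∧ ∀ j : ℕ, (j : ℤ) ≤ p → β - (j : ℤ) • α ∈ roots H := by
  obtain ⟨e, he, f, hf, t⟩ := hG.exists_isSl2Triple hα
  obtain ⟨v, hv, hv0⟩ := exists_of_mem_roots hβ
  obtain ⟨k, hk0, hk⟩ := exists_last_iterate _ hv0 (hG.locally_nilpotent α hα e he v)
  have hw := ad_pow_mem_rootSpace he hv k
  obtain ⟨N, hN, hN'⟩ := exists_nat_of_primitive t (w := ((LieAlgebra.ad ℂ G e) ^ k) v)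
    ⟨hk0, hG.lie_coroot hw α, hk⟩
    (hG.locally_nilpotent _ (hG.neg_mem_nonisotropicRoots hα) f hf _)
  refine ⟨N - 2 * k, ?_, fun j hj => ?_⟩
  · rw [LinearMap.add_apply, LinearMap.smul_apply, hG.apply_coroot_self hα] at hN
    simp only [zsmul_eq_mul] at hN
    push_cast at hN ⊢
    linear_combination hN
  · have := mem_roots_of_mem (ad_pow_mem_rootSpace hf hw (k + j)) (hN' (k + j) (by omega))
    rwa [show β + (k : ℤ) • α + ((k + j : ℕ) : ℤ) • -α = β - (j : ℤ) • α by push_cast; module]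
      at this

lemma exists_int (hα : α ∈ nonisotropicRoots form H) (hβ : β ∈ roots H) :
    ∃ p : ℤ, β (hG.coroot α) = p := (hG.exists_int_string hα hβ).imp fun _ h => h.1

lemma reflection_mem_roots (hα : α ∈ nonisotropicRoots form H) (hβ : β ∈ roots H) :
    β - β (hG.coroot α) • α ∈ roots H := by
  obtain ⟨p, hp, hs⟩ := hG.exists_int_string hα hβ
  rw [hp, Int.cast_smul_eq_zsmul]
  rcases le_total 0 p with h | h
  · have := hs p.toNat (by omega)
    rwa [Int.toNat_of_nonneg h] at this
  · obtain ⟨q, hq, hs'⟩ := hG.exists_int_string (hG.neg_mem_nonisotropicRoots hα) hβ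
    rw [hG.coroot_neg, map_neg, hp] at hq
    have hpq : q = -p := by exact_mod_cast hq.symm
    have := hs' (-p).toNat (by omega)
    rwa [Int.toNat_of_nonneg (by omega), smul_neg, neg_smul, neg_neg] at this

lemma ip_reflection (hα : α ∈ nonisotropicRoots form H) (β : Module.Dual ℂ H) :
    hG.ip (β - β (hG.coroot α) • α) (β - β (hG.coroot α) • α) = hG.ip β β := by
  have := (hG.mem_nonisotropicRoots.1 hα).2
  rw [hG.apply_coroot]
  simp only [ip_sub_left, ip_sub_right, ip_smul_left, ip_smul_right, hG.ip_comm β α]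
  field_simp
  ring

lemma reflection_mem (hα : α ∈ nonisotropicRoots form H) (hβ : β ∈ nonisotropicRoots form H) :
    β - β (hG.coroot α) • α ∈ nonisotropicRoots form H := by
  rw [hG.mem_nonisotropicRoots]
  refine ⟨hG.reflection_mem_roots hα (hG.mem_nonisotropicRoots.1 hβ).1, ?_⟩
  rw [hG.ip_reflection hα]
  exact (hG.mem_nonisotropicRoots.1 hβ).2

/-- Root spaces of non-isotropic roots are one-dimensional: a vector of `G_α` orthogonal to
`f ∈ G_{-α}` is killed by `ad f`, so it would be a lowest weight vector of positive weight `2`. -/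
lemma exists_rootSpace_eq_span (hα : α ∈ nonisotropicRoots form H) :
    ∃ e ∈ rootSpace H α, ∃ f ∈ rootSpace H (-α), ⁅e, f⁆ = (hG.coroot α : G) ∧
      ∀ x ∈ rootSpace H α, ∃ c : ℂ, x = c • e := by
  obtain ⟨e, he, f, hf, t⟩ := hG.exists_isSl2Triple hα
  refine ⟨e, he, f, hf, t.lie_e_f, fun x hx => ?_⟩
  have hef : form e f ≠ 0 := fun hc => by
    have := t.lie_e_f
    rw [hG.lie_eq_smul_rep he hf, hc, zero_smul] at this
    exact t.h_ne_zero this.symm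
  refine ⟨form x f / form e f, ?_⟩
  by_contra hne
  have hy : x - (form x f / form e f) • e ∈ rootSpace H α :=
    Submodule.sub_mem _ hx (Submodule.smul_mem _ _ he)
  have hyf : form (x - (form x f / form e f) • e) f = 0 := by
    simp [hef]
  obtain ⟨N, hN, -⟩ := exists_nat_of_primitive t.symm (w := x - (form x f / form e f) • e)
    (μ := -2) ⟨sub_ne_zero.2 hne, by
      rw [neg_lie, hG.lie_coroot hy, hG.apply_coroot_self hα, neg_smul], by
      rw [← lie_skew, hG.lie_eq_smul_rep hy hf, hyf, zero_smul, neg_zero]⟩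
    (hG.locally_nilpotent α hα e he _)
  have : ((-2 : ℤ) : ℂ) = (N : ℤ) := by exact_mod_cast hN
  have := Int.cast_injective this
  omega

/-- A Heisenberg argument: if `δ` is isotropic and not orthogonal to the root `α`, then the
`δ`-string through `α` is infinite. -/
lemma infinite_isotropic_string (hδ : δ ∈ roots H) (h0 : hG.ip δ δ = 0) (hα : α ∈ roots H)
    (h : hG.ip δ α ≠ 0) : ∃ (k : ℤ) (ε : ℤ), |ε| = 1 ∧
      ∀ n : ℕ, α + (k + ε * n) • δ ∈ roots H := by
  obtain ⟨e, he, he0⟩ := exists_of_mem_roots hδ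
  obtain ⟨f, hf, hef⟩ := hG.exists_form_eq_one he he0
  obtain ⟨v, hv, hv0⟩ := exists_of_mem_roots hα
  by_cases hn : ∃ n : ℕ, ((LieAlgebra.ad ℂ G e) ^ n) v = 0
  · obtain ⟨k, hk0, hk⟩ := exists_last_iterate _ hv0 hn
    have hw : ((LieAlgebra.ad ℂ G e) ^ k) v ∈ rootSpace H (α + (k : ℤ) • δ) :=
      ad_pow_mem_rootSpace he hv k
    generalize ((LieAlgebra.ad ℂ G e) ^ k) v = w at hk0 hk hw
    have key : ∀ n : ℕ, ⁅e, ((LieAlgebra.ad ℂ G f) ^ (n + 1)) w⁆ =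
        ((n + 1) * hG.ip δ α) • ((LieAlgebra.ad ℂ G f) ^ n) w := by
      intro n
      have hz : ∀ n : ℕ, ⁅⁅e, f⁆, ((LieAlgebra.ad ℂ G f) ^ n) w⁆ =
          hG.ip δ α • ((LieAlgebra.ad ℂ G f) ^ n) w := by
        intro n
        rw [hG.lie_eq_smul_rep he hf, hef, one_smul, ad_pow_mem_rootSpace hf hw n, hG.apply_rep]
        simp only [ip_add_right, ip_zsmul_right, ip_neg_right, h0, neg_zero, mul_zero, add_zero]
      induction n with
      | zero =>
        simp only [zero_add, pow_one, LieAlgebra.ad_apply, pow_zero, Module.End.one_apply]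
        have := hz 0
        simp only [pow_zero, Module.End.one_apply] at this
        rw [leibniz_lie, this, show ⁅e, w⁆ = 0 from hk, lie_zero]
        simp
      | succ n ih =>
        rw [pow_succ' _ (n + 1), Module.End.mul_apply, LieAlgebra.ad_apply, leibniz_lie, hz, ih,
          lie_smul, ← LieAlgebra.ad_apply ℂ, ← Module.End.mul_apply, ← pow_succ', ← add_smul]
        congr 1
        push_cast
        ring
    have hne : ∀ n : ℕ, ((LieAlgebra.ad ℂ G f) ^ n) w ≠ 0 := by
      intro n
      induction n with
      | zero => simpa using hk0
      | succ n ih =>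
        intro hc
        have := key n
        rw [hc, lie_zero, eq_comm, smul_eq_zero_iff_left ih, mul_eq_zero] at this
        exact this.elim (by exact_mod_cast n.succ_ne_zero) h
    refine ⟨k, -1, by simp, fun n => ?_⟩
    have := mem_roots_of_mem (ad_pow_mem_rootSpace hf hw n) (hne n)
    rwa [show α + (k : ℤ) • δ + (n : ℤ) • -δ = α + (k + -1 * (n : ℤ)) • δ by module] at this
  · push Not at hn
    refine ⟨0, 1, by simp, fun n => ?_⟩
    have := mem_roots_of_mem (ad_pow_mem_rootSpace he hv n) (hn n)
    rwa [show α + (n : ℤ) • δ = α + (0 + 1 * (n : ℤ)) • δ by module] at this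

/-- Isotropic roots are orthogonal to all non-isotropic roots. Otherwise `2(α, β)/(β, β)` is an
integer for infinitely many `β = α + mδ`, while it tends to `1` without being `1`. -/
lemma ip_eq_zero_of_isotropic (hδ : δ ∈ roots H) (h0 : hG.ip δ δ = 0)
    (hα : α ∈ nonisotropicRoots form H) : hG.ip δ α = 0 := by
  obtain ⟨hαr, hαn⟩ := hG.mem_nonisotropicRoots.1 hα
  by_contra hc
  obtain ⟨k, ε, hε, hs⟩ := hG.infinite_isotropic_string hδ h0 hαr hc
  -- integrality bounds the position of a root in the string
  have bound : ∀ m : ℤ, α + m • δ ∈ roots H →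
      ‖(m : ℂ)‖ * ‖hG.ip δ α‖ ≤ ‖hG.ip α α‖ := by
    intro m hm
    have hnorm : hG.ip (α + m • δ) (α + m • δ) = hG.ip α α + 2 * m * hG.ip δ α := by
      simp only [ip_add_left, ip_add_right, ip_zsmul_left, ip_zsmul_right, h0, hG.ip_comm α δ]
      ring
    have h2 : 2 * (‖(m : ℂ)‖ * ‖hG.ip δ α‖) = ‖2 * m * hG.ip δ α‖ := by
      rw [norm_mul, norm_mul]; simp [mul_assoc]
    suffices ‖hG.ip α α + 2 * m * hG.ip δ α‖ ≤ ‖hG.ip α α‖ by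
      have h3 := norm_sub_le (hG.ip α α + 2 * m * hG.ip δ α) (hG.ip α α)
      rw [add_sub_cancel_left, ← h2] at h3
      linarith
    by_cases hz : hG.ip α α + 2 * m * hG.ip δ α = 0
    · rw [hz, norm_zero]; exact norm_nonneg _
    obtain ⟨p, hp⟩ := hG.exists_int (α := α + m • δ)
      (hG.mem_nonisotropicRoots.2 ⟨hm, by rwa [hnorm]⟩) hαr
    rw [hG.apply_coroot, hnorm, div_eq_iff hz] at hp
    simp only [ip_add_left, ip_zsmul_left] at hp
    have hp' : hG.ip α α = ((p - 1 : ℤ) : ℂ) * (hG.ip α α + 2 * m * hG.ip δ α) := by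
      push_cast; linear_combination hp
    have hp1 : p - 1 ≠ 0 := fun hc => hαn (by rw [hp', hc]; simp)
    have hp2 : (1 : ℝ) ≤ ‖((p - 1 : ℤ) : ℂ)‖ := by
      rw [Complex.norm_intCast]; exact_mod_cast Int.one_le_abs hp1
    calc _ ≤ ‖((p - 1 : ℤ) : ℂ)‖ * ‖hG.ip α α + 2 * m * hG.ip δ α‖ :=
          le_mul_of_one_le_left (norm_nonneg _) hp2
      _ = _ := by rw [← norm_mul, ← hp']
  have hcpos : 0 < ‖hG.ip δ α‖ := norm_pos_iff.2 hc
  obtain ⟨n, hn⟩ := exists_nat_gt (‖hG.ip α α‖ / ‖hG.ip δ α‖ + |(k : ℝ)|)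
  have h1 := (le_div_iff₀ hcpos).2 (bound _ (hs n))
  rw [Complex.norm_intCast] at h1
  have h2 : (n : ℝ) ≤ |((k + ε * n : ℤ) : ℝ)| + |(k : ℝ)| := by
    have hε' : |(ε : ℝ)| = 1 := by exact_mod_cast hε
    calc (n : ℝ) = |(ε : ℝ) * n| := by rw [abs_mul, hε', one_mul, Nat.abs_cast]
      _ = |((k + ε * n : ℤ) : ℝ) - k| := by push_cast; ring_nf
      _ ≤ _ := abs_sub _ _
  linarith

/-! ### Bounds for the Cartan integers -/

/-- Non-isotropic roots of equal length have Cartan integer at most `2`. If it is `p ≥ 3`, then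
reflecting produces a pair with Cartan integer `P = p² - 2 ≥ 7`, and the third element of the root
string violates integrality. -/
lemma abs_le_two_of_ip_eq (hα : α ∈ nonisotropicRoots form H) (hβ : β ∈ nonisotropicRoots form H)
    (h : hG.ip β β = hG.ip α α) {p : ℤ} (hp : β (hG.coroot α) = p) : |p| ≤ 2 := by
  obtain ⟨hαr, hαn⟩ := hG.mem_nonisotropicRoots.1 hα
  by_contra! hlt
  set a := hG.ip α α
  have hab : 2 * hG.ip α β = p * a := by rw [hG.apply_coroot, div_eq_iff hαn] at hp; exact hp
  have hq : α (hG.coroot β) = p := by rw [hG.apply_coroot, h, hG.ip_comm, ← hp, hG.apply_coroot]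
  have hy := hG.neg_mem_nonisotropicRoots (hG.reflection_mem hβ hα)
  have hyy : hG.ip (-(α - α (hG.coroot β) • β)) (-(α - α (hG.coroot β) • β)) = a := by
    simp only [ip_neg_left, ip_neg_right, neg_neg]; exact hG.ip_reflection hβ α
  have hαy : 2 * hG.ip α (-(α - α (hG.coroot β) • β)) = ((p ^ 2 - 2 : ℤ) : ℂ) * a := by
    rw [hq]; simp only [ip_neg_right, ip_sub_right, ip_smul_right]; push_cast
    linear_combination (p : ℂ) * hab
  generalize -(α - α (hG.coroot β) • β) = y at hy hyy hαy
  obtain ⟨P, hP⟩ : ∃ P, P = p ^ 2 - 2 := ⟨_, rfl⟩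
  rw [← hP] at hαy
  have hP7 : 7 ≤ P := by
    have : 3 * 3 ≤ |p| * |p| := mul_le_mul hlt hlt (by norm_num) (abs_nonneg p)
    rw [abs_mul_abs_self] at this
    rw [hP]; nlinarith
  obtain ⟨P', hP', hs⟩ := hG.exists_int_string hα (hG.mem_nonisotropicRoots.1 hy).1
  rw [hG.apply_coroot, hαy, mul_div_cancel_right₀ _ hαn] at hP'
  obtain rfl : P = P' := by exact_mod_cast hP'
  have hz := hs 2 (by push_cast; omega)
  have hzz : hG.ip (y - ((2 : ℕ) : ℤ) • α) (y - ((2 : ℕ) : ℤ) • α) = ((5 - 2 * P : ℤ) : ℂ) * a := by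
    simp only [ip_sub_left, ip_sub_right, ip_zsmul_left, ip_zsmul_right, hyy, hG.ip_comm y α]
    push_cast
    linear_combination (-2 : ℂ) * hαy
  have h52 : 5 - 2 * P ≠ 0 := by omega
  have h52' : ((5 - 2 * P : ℤ) : ℂ) * a ≠ 0 := mul_ne_zero (by exact_mod_cast h52) hαn
  obtain ⟨q, hq⟩ := hG.exists_int (hG.mem_nonisotropicRoots.2 ⟨hz, by rwa [hzz]⟩) hαr
  rw [hG.apply_coroot, hzz, div_eq_iff h52'] at hq
  have hq' : ((P - 4 : ℤ) : ℂ) = ((q * (5 - 2 * P) : ℤ) : ℂ) := by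
    refine mul_right_cancel₀ hαn ?_
    simp only [ip_sub_left, ip_zsmul_left, hG.ip_comm y α] at hq
    push_cast at hq ⊢
    linear_combination hq - hαy
  have hq'' : P - 4 = q * (5 - 2 * P) := by exact_mod_cast hq'
  have : (2 * P - 5) ∣ (P - 4) := ⟨-q, by rw [hq'']; ring⟩
  have := Int.le_of_dvd (by omega) this
  omega

lemma ip_eq_zero_iff (hα : α ∈ nonisotropicRoots form H) :
    β (hG.coroot α) = 0 ↔ hG.ip α β = 0 := by
  have := (hG.mem_nonisotropicRoots.1 hα).2
  rw [hG.apply_coroot, div_eq_zero_iff]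
  simp [this]

/-- With `p = ⟨β, α^∨⟩` and `q = ⟨α, β^∨⟩`, the reflection of `α` in `β` has the length of `α` and
pairs with `α^∨` to `2 - p q`, so that the case of equal lengths bounds `p q`. -/
lemma abs_le_four (hα : α ∈ nonisotropicRoots form H) (hβ : β ∈ nonisotropicRoots form H)
    {p : ℤ} (hp : β (hG.coroot α) = p) : |p| ≤ 4 := by
  obtain ⟨hαr, hαn⟩ := hG.mem_nonisotropicRoots.1 hα
  obtain ⟨hβr, hβn⟩ := hG.mem_nonisotropicRoots.1 hβ
  obtain ⟨q, hq⟩ := hG.exists_int hβ hαr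
  have h1 := hG.abs_le_two_of_ip_eq hα (hG.reflection_mem hβ hα) (hG.ip_reflection hβ α)
    (p := 2 - q * p) (by
      rw [LinearMap.sub_apply, LinearMap.smul_apply, hG.apply_coroot_self hα, hp, hq]
      push_cast; rfl)
  by_cases hp0 : p = 0
  · simp [hp0]
  have hq0 : q ≠ 0 := by
    rintro rfl
    rw [Int.cast_zero, hG.ip_eq_zero_iff hβ, hG.ip_comm, ← hG.ip_eq_zero_iff hα, hp] at hq
    exact hp0 (by exact_mod_cast hq)
  rw [abs_le] at h1
  have h2 : |q * p| ≤ 4 := by rw [abs_le]; omega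
  rw [abs_mul] at h2
  have := Int.one_le_abs hq0
  nlinarith [abs_nonneg p]

end IsGRLA

/-! ### The finite root system of a connected set of roots -/

section RootSets

open Module

variable {E : Type*} [AddCommGroup E] [Module ℂ E]

/-- A set `C` of linear forms with coroots `cr`, stable under reflections, with bounded integral
pairings and a symmetric orthogonality relation. The last two conditions hold whenever the coroots
come from a symmetric form through `cr α = 2 t_α / (α, α)`. Neither finiteness of `C` nor any
positivity is assumed. -/
structure IsRootSet (C : Set (Dual ℂ E)) (cr : Dual ℂ E → E) : Prop where
  apply_self : ∀ α ∈ C, α (cr α) = 2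
  int : ∀ α ∈ C, ∀ β ∈ C, ∃ p : ℤ, β (cr α) = p ∧ |p| ≤ 4
  reflection_mem : ∀ α ∈ C, ∀ β ∈ C, β - β (cr α) • α ∈ C
  orthogonal_symm : ∀ α ∈ C, ∀ β ∈ C, β (cr α) = 0 → α (cr β) = 0
  coroot_eq_iff : ∀ α ∈ C, ∀ β ∈ C, (∀ γ ∈ C, γ (cr α) = γ (cr β)) ↔
    ∀ γ ∈ C, α (cr γ) = β (cr γ)

/-- Connectedness of a set of roots with respect to non-orthogonality. -/
structure IsConnectedRootSet (C : Set (Dual ℂ E)) (cr : Dual ℂ E → E) : Prop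
    extends IsRootSet C cr where
  nonempty : C.Nonempty
  eq_of_closed : ∀ A ⊆ C, A.Nonempty → (∀ α ∈ A, ∀ β ∈ C, β (cr α) ≠ 0 → β ∈ A) → A = C

variable {C : Set (Dual ℂ E)} {cr : Dual ℂ E → E}

namespace IsRootSet

variable (hC : IsRootSet C cr)
include hC

lemma reflection_mem_int {α β : Dual ℂ E} (hα : α ∈ C) (hβ : β ∈ C) {p : ℤ}
    (hp : β (cr α) = p) : β - p • α ∈ C := by
  have := hC.reflection_mem α hα β hβ
  rwa [hp, Int.cast_smul_eq_zsmul] at this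

lemma neg_mem {α : Dual ℂ E} (hα : α ∈ C) : -α ∈ C := by
  have := hC.reflection_mem_int hα hα (p := 2) (by simpa using hC.apply_self α hα)
  rwa [show α - (2 : ℤ) • α = -α by module] at this

lemma exists_int_of_mem_closure {α φ : Dual ℂ E} (hα : α ∈ C) (hφ : φ ∈ AddSubgroup.closure C) :
    ∃ p : ℤ, φ (cr α) = p := by
  induction hφ using AddSubgroup.closure_induction with
  | mem β hβ => exact (hC.int α hα β hβ).imp fun _ h => h.1
  | zero => exact ⟨0, by simp⟩
  | add φ ψ _ _ h1 h2 =>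
    obtain ⟨p, hp⟩ := h1
    obtain ⟨q, hq⟩ := h2
    exact ⟨p + q, by simp [hp, hq]⟩
  | neg φ _ h =>
    obtain ⟨p, hp⟩ := h
    exact ⟨-p, by simp [hp]⟩

omit hC in
lemma exists_finite_spanning_coroots [FiniteDimensional ℂ E] (C : Set (Dual ℂ E))
    (cr : Dual ℂ E → E) : ∃ (n : ℕ) (b : Fin n → Dual ℂ E), (∀ j, b j ∈ C) ∧
      ∀ α ∈ C, cr α ∈ Submodule.span ℂ (Set.range fun j => cr (b j)) := by
  obtain ⟨B, hB, hspan, hli⟩ := exists_linearIndependent ℂ (cr '' C)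
  have hfin : B.Finite := hli.setFinite
  obtain ⟨n, e, -, he⟩ := hfin.fin_param
  have : ∀ j, ∃ γ ∈ C, cr γ = e j := fun j => hB (he ▸ Set.mem_range_self j)
  choose b hb hbe using this
  refine ⟨n, b, hb, fun α hα => ?_⟩
  have : (fun j => cr (b j)) = e := funext hbe
  rw [this, he, hspan]
  exact Submodule.subset_span ⟨α, hα, rfl⟩

/-- The coordinates of a linear form given by its (real) values on the coroots of `b`. -/
noncomputable def coord {n : ℕ} (b : Fin n → Dual ℂ E) (cr : Dual ℂ E → E) :
    Dual ℂ E →+ (Fin n → ℝ) where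
  toFun φ j := (φ (cr (b j))).re
  map_zero' := by ext; simp
  map_add' φ ψ := by ext; simp

lemma finite_coord_image {n : ℕ} {b : Fin n → Dual ℂ E} (hb : ∀ j, b j ∈ C) :
    (coord b cr '' C).Finite := by
  refine ((Set.Finite.pi' (t := fun _ : Fin n => ((↑) : ℤ → ℝ) '' Set.Icc (-4) 4)
    fun _ => (Set.finite_Icc (-4 : ℤ) 4).image _)).subset ?_
  rintro _ ⟨α, hα, rfl⟩ j
  obtain ⟨p, hp, hp4⟩ := hC.int (b j) (hb j) α hα
  exact ⟨p, abs_le.1 hp4, by simp [coord, hp]⟩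

/-- Every coroot acts on the lattice spanned by `C` through a real functional of the
coordinates. -/
lemma exists_dual_coord {n : ℕ} {b : Fin n → Dual ℂ E} (hb : ∀ j, b j ∈ C)
    (hspan : ∀ α ∈ C, cr α ∈ Submodule.span ℂ (Set.range fun j => cr (b j)))
    {α : Dual ℂ E} (hα : α ∈ C) : ∃ f : Dual ℝ (Fin n → ℝ),
      ∀ φ ∈ AddSubgroup.closure C, ((f (coord b cr φ) : ℝ) : ℂ) = φ (cr α) := by
  obtain ⟨c, hc⟩ := (Submodule.mem_span_range_iff_exists_fun ℂ).1 (hspan α hα)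
  refine ⟨∑ j, (c j).re • LinearMap.proj j, fun φ hφ => ?_⟩
  obtain ⟨p, hp⟩ := hC.exists_int_of_mem_closure hα hφ
  have hz := fun j => hC.exists_int_of_mem_closure (hb j) hφ
  choose z hz using hz
  have h1 : φ (cr α) = ∑ j, c j * z j := by rw [← hc]; simp [hz]
  have h2 : (φ (cr α)).re = ∑ j, (c j).re * z j := by rw [h1]; simp
  have h3 : φ (cr α) = ((φ (cr α)).re : ℂ) := by rw [hp]; simp
  rw [h3, h2]
  simp [coord, hz]

end IsRootSet

/-- The roots of `C` modulo those combinations on which all coroots vanish form a finite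
irreducible crystallographic root system. The map `ρ` is the reduction. -/
theorem IsConnectedRootSet.exists_rootPairing [FiniteDimensional ℂ E]
    (hC : IsConnectedRootSet C cr) :
    ∃ (ι M : Type) (_ : AddCommGroup M) (_ : Module ℝ M) (P : RootPairing ι ℝ M (Dual ℝ M))
      (ρ : AddSubgroup.closure C →+ M), Finite ι ∧ P.IsRootSystem ∧ P.IsCrystallographic ∧
      P.IsIrreducible ∧
      (∀ φ : AddSubgroup.closure C, (φ : Dual ℂ E) ∈ C → ∃ i, ρ φ = P.root i) ∧
      (∀ i, ∃ φ : AddSubgroup.closure C, (φ : Dual ℂ E) ∈ C ∧ ρ φ = P.root i) ∧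
      (∀ (α : AddSubgroup.closure C) (i : ι), (α : Dual ℂ E) ∈ C → ρ α = P.root i →
        ∀ φ : AddSubgroup.closure C,
          ((P.coroot' i (ρ φ) : ℝ) : ℂ) = (φ : Dual ℂ E) (cr α)) := by
  obtain ⟨n, b, hb, hspan⟩ := IsRootSet.exists_finite_spanning_coroots C cr
  set π := IsRootSet.coord b cr with hπ
  have hfin : (π '' C).Finite := hC.finite_coord_image hb
  let M := Submodule.span ℝ (π '' C)
  have : Finite (π '' C) := hfin
  have : FiniteDimensional ℝ M := FiniteDimensional.span_of_finite ℝ hfin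
  have hQM : ∀ φ ∈ AddSubgroup.closure C, π φ ∈ M := by
    intro φ hφ
    induction hφ using AddSubgroup.closure_induction with
    | mem β hβ => exact Submodule.subset_span ⟨β, hβ, rfl⟩
    | zero => rw [map_zero]; exact zero_mem _
    | add φ ψ _ _ h1 h2 => rw [map_add]; exact add_mem h1 h2
    | neg φ _ h => rw [map_neg]; exact neg_mem h
  let ρ : AddSubgroup.closure C →+ M :=
    { toFun φ := ⟨π φ, hQM φ φ.2⟩
      map_zero' := Subtype.ext (map_zero π)
      map_add' φ ψ := Subtype.ext (map_add π _ _) }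
  have hsub := AddSubgroup.subset_closure (k := C)
  let lift : π '' C → Dual ℂ E := fun v => v.2.choose
  have hlift : ∀ v, lift v ∈ C := fun v => v.2.choose_spec.1
  have hπlift : ∀ v, π (lift v) = v := fun v => v.2.choose_spec.2
  have hf := fun v : π '' C => hC.exists_dual_coord hb hspan (hlift v)
  choose f hf using hf
  let root : π '' C ↪ M :=
    ⟨fun v => ⟨v, Submodule.subset_span v.2⟩, fun v w h =>
      Subtype.ext (congrArg (Subtype.val : M → _) h)⟩
  have hρ : ∀ v, ρ ⟨lift v, hsub (hlift v)⟩ = root v := fun v => Subtype.ext (hπlift v)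
  let cor : π '' C → Dual ℝ M := fun v => (f v).comp M.subtype
  have hcor : ∀ v (φ : AddSubgroup.closure C),
      ((cor v (ρ φ) : ℝ) : ℂ) = (φ : Dual ℂ E) (cr (lift v)) := fun v φ => hf v φ φ.2
  -- `π` sees the pairings with all coroots
  have hπeq : ∀ φ ∈ AddSubgroup.closure C, ∀ ψ ∈ AddSubgroup.closure C, π φ = π ψ →
      ∀ γ ∈ C, φ (cr γ) = ψ (cr γ) := by
    intro φ hφ ψ hψ h γ hγ
    obtain ⟨g, hg⟩ := hC.exists_dual_coord hb hspan hγ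
    rw [← hg φ hφ, ← hg ψ hψ, ← hπ, h]
  have hcor_eq : ∀ v : π '' C, ∀ α ∈ C, π α = v → ∀ φ ∈ AddSubgroup.closure C,
      φ (cr (lift v)) = φ (cr α) := by
    intro v α hα hv φ hφ
    have h1 := (hC.coroot_eq_iff _ (hlift v) α hα).2
      (hπeq _ (hsub (hlift v)) _ (hsub hα) (by rw [hπlift, hv]))
    induction hφ using AddSubgroup.closure_induction with
    | mem β hβ => exact h1 β hβ
    | zero => simp
    | add φ ψ _ _ h2 h3 => simp [h2, h3]
    | neg φ _ h2 => simp [h2]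
  have hcor_inj : Function.Injective cor := by
    intro v w h
    have h1 : ∀ γ ∈ C, γ (cr (lift v)) = γ (cr (lift w)) := fun γ hγ => by
      rw [← hcor v ⟨γ, hsub hγ⟩, ← hcor w ⟨γ, hsub hγ⟩, h]
    have h2 := (hC.coroot_eq_iff _ (hlift v) _ (hlift w)).1 h1
    refine Subtype.ext ?_
    rw [← hπlift v, ← hπlift w]
    funext j
    simp [hπ, IsRootSet.coord, h2 _ (hb j)]
  have hroot : ∀ φ : AddSubgroup.closure C, ∀ hφ : (φ : Dual ℂ E) ∈ C,
      ρ φ = root ⟨π φ, φ, hφ, rfl⟩ := fun φ hφ => rfl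
  have hpair : ∀ v, ∀ φ : AddSubgroup.closure C, ∃ p : ℤ, cor v (ρ φ) = p ∧
      (φ : Dual ℂ E) (cr (lift v)) = p := by
    intro v φ
    obtain ⟨p, hp⟩ := hC.exists_int_of_mem_closure (hlift v) φ.2
    refine ⟨p, ?_, hp⟩
    rw [← hcor] at hp
    exact_mod_cast hp
  let coroot : π '' C ↪ Dual ℝ M := ⟨cor, hcor_inj⟩
  have h2 : ∀ v, Dual.eval ℝ M (root v) (coroot v) = 2 := by
    intro v
    have := hcor v ⟨lift v, hsub (hlift v)⟩
    rw [hρ, hC.apply_self _ (hlift v)] at this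
    exact_mod_cast this
  have hs : ∀ v, Set.MapsTo (preReflection (root v) ((Dual.eval ℝ M).flip (coroot v)))
      (Set.range root) (Set.range root) := by
    rintro v _ ⟨w, rfl⟩
    obtain ⟨p, hp, hp'⟩ := hpair v ⟨lift w, hsub (hlift w)⟩
    have hmem := hC.reflection_mem_int (hlift v) (hlift w) hp'
    refine ⟨⟨π (lift w - p • lift v), _, hmem, rfl⟩, ?_⟩
    rw [← hroot ⟨_, hsub hmem⟩ hmem, preReflection_apply]
    have : (⟨lift w - p • lift v, hsub hmem⟩ : AddSubgroup.closure C) =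
      ⟨lift w, hsub (hlift w)⟩ - p • ⟨lift v, hsub (hlift v)⟩ := rfl
    rw [this, map_sub, map_zsmul, hρ, hρ]
    rw [hρ] at hp
    change _ = root w - cor v (root w) • root v
    rw [hp, ← Int.cast_smul_eq_zsmul ℝ]
  have hsp : Submodule.span ℝ (Set.range root) = ⊤ := by
    rw [eq_top_iff]
    rintro ⟨x, hx⟩ -
    induction hx using Submodule.span_induction with
    | mem x hx => exact Submodule.subset_span ⟨⟨x, hx⟩, rfl⟩
    | zero => exact zero_mem _
    | add x y hx hy h1 h2 => exact add_mem h1 h2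
    | smul a x hx h => exact Submodule.smul_mem _ a h
  have hint : ∀ v w, ∃ z : ℤ, z = Dual.eval ℝ M (root v) (coroot w) := by
    intro v w
    obtain ⟨p, hp, -⟩ := hpair w ⟨lift v, hsub (hlift v)⟩
    exact ⟨p, by rw [← hp, hρ]; rfl⟩
  let P := RootPairing.mk'' (Dual.eval ℝ M) root coroot h2 hs hsp
  have hPs : P.IsRootSystem := RootPairing.isRootSystem_mk'' hint
  have hcoroot' : ∀ v x, P.coroot' v x = cor v x := fun v x => rfl
  have hproot : ∀ v, P.root v = root v := fun v => rfl
  refine ⟨_, M, _, _, P, ρ, hfin, hPs, ⟨hint⟩, ?_, fun φ hφ => ⟨_, hroot φ hφ⟩,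
    fun v => ⟨⟨lift v, hsub (hlift v)⟩, hlift v, hρ v⟩, ?_⟩
  · obtain ⟨α₀, hα₀⟩ := hC.nonempty
    have : Nonempty (π '' C) := ⟨⟨π α₀, α₀, hα₀, rfl⟩⟩
    have : Nontrivial M := ⟨⟨_, _, P.ne_zero (Classical.arbitrary _)⟩⟩
    refine RootPairing.IsIrreducible.mk' P fun q hq hq0 => ?_
    let q' : P.invtRootSubmodule := ⟨q, P.mem_invtRootSubmodule_iff.2 hq⟩
    let A : Set (Dual ℂ E) := {α | ∃ h : α ∈ C, ρ ⟨α, hsub h⟩ ∈ q}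
    have hAC : A ⊆ C := fun α h => h.1
    rcases A.eq_empty_or_nonempty with hA | hA
    · refine absurd ?_ hq0
      rw [Submodule.eq_bot_iff]
      intro x hx
      refine P.eq_zero_iff_forall_coroot'_eq_zero.2 fun v => ?_
      refine RootPairing.invtRootSubmodule.le_ker_coroot' q' (fun hv => ?_) hx
      have : lift v ∈ A := ⟨hlift v, by rw [hρ]; exact hv⟩
      simp [hA] at this
    · have hAeq := hC.eq_of_closed A hAC hA ?_
      · rw [eq_top_iff, ← hsp, Submodule.span_le]
        rintro _ ⟨v, rfl⟩
        have h : lift v ∈ A := hAeq ▸ hlift v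
        obtain ⟨_, h⟩ := h
        rwa [hρ] at h
      · rintro α ⟨hα, hαq⟩ β hβ hne
        refine ⟨hβ, ?_⟩
        by_contra hβq
        let v : π '' C := ⟨π β, β, hβ, rfl⟩
        have h1 : P.coroot' v (ρ ⟨α, hsub hα⟩) = 0 :=
          RootPairing.invtRootSubmodule.le_ker_coroot' q' (k := v) hβq hαq
        rw [hcoroot'] at h1
        have h3 := hcor v ⟨α, hsub hα⟩
        rw [h1, hcor_eq v β hβ rfl _ (hsub hα)] at h3
        exact hne (hC.orthogonal_symm _ hβ _ hα (by simpa using h3.symm))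
  · intro α v hα hv φ
    rw [hcoroot', hcor, hcor_eq v α hα ?_ φ φ.2]
    exact congrArg (Subtype.val : M → _) hv

end RootSets

/-! ### Lattice bases consisting of roots, for possibly non-reduced root systems -/

section Indivisible

universe u

variable {ι : Type u} {M N : Type*} [AddCommGroup M] [Module ℝ M] [AddCommGroup N] [Module ℝ N]
  (P : RootPairing ι ℝ M N)

/-- The reduced root system of indivisible roots. -/
def indivisible : RootPairing {i // ∀ j, P.root i ≠ (2 : ℝ) • P.root j} ℝ M N where
  toLinearMap := P.toLinearMap
  root := (Function.Embedding.subtype _).trans P.root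
  coroot := (Function.Embedding.subtype _).trans P.coroot
  root_coroot_two i := P.root_coroot_two i
  reflectionPerm i := (P.reflectionPerm i).subtypeEquiv fun j => by
    refine ⟨fun h k hk => h (P.reflectionPerm i k) ?_, fun h k hk => h (P.reflectionPerm i k) ?_⟩
    · rw [P.root_reflectionPerm, ← map_smul, ← hk, P.root_reflectionPerm,
        P.reflection_same]
    · rw [P.root_reflectionPerm, P.root_reflectionPerm, hk, map_smul]
  reflectionPerm_root i j := P.reflectionPerm_root i j
  reflectionPerm_coroot i j := P.reflectionPerm_coroot i j

instance [P.IsCrystallographic] : (indivisible P).IsCrystallographic :=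
  ⟨fun i j => P.exists_value (S := ℤ) i j⟩

lemma neg_two_smul_root_eq (j : ι) :
    (-2 : ℝ) • P.root j = (2 : ℝ) • P.root (P.reflectionPerm j j) := by
  rw [P.root_reflectionPerm, P.reflection_apply_self]; module

variable [P.IsCrystallographic]

/-- If `root i = 2 root j`, then `root j` is indivisible. -/
lemma indivisible_of_root_eq_two_smul {i j : ι} (h : P.root i = (2 : ℝ) • P.root j) (k : ι) :
    P.root j ≠ (2 : ℝ) • P.root k := by
  intro hk
  obtain ⟨z, hz⟩ := P.exists_value (S := ℤ) k i
  have h1 : P.pairing i i = 4 * P.pairing k i := by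
    rw [← P.root_coroot'_eq_pairing, ← P.root_coroot'_eq_pairing]
    conv_lhs => rw [h, hk]
    rw [map_smul, map_smul, smul_eq_mul, smul_eq_mul]; ring
  rw [P.pairing_same, ← hz] at h1
  have : (2 : ℤ) = 4 * z := by
    have h2 : (2 : ℝ) = 4 * z := h1
    exact_mod_cast h2
  omega

variable [Finite ι]

instance : (indivisible P).IsReduced where
  eq_or_eq_neg i j h := by
    have : Module.IsReflexive ℝ M := .of_isPerfPair P.toLinearMap
    have : Module.IsReflexive ℝ N := .of_isPerfPair P.flip.toLinearMap
    have h4 : P.pairingIn ℤ i j * P.pairingIn ℤ j i = 4 :=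
      (P.coxeterWeightIn_eq_four_iff_not_linearIndependent ℤ).2 h
    have hmem := P.pairingIn_pairingIn_mem_set_of_isCrystallographic i j
    simp only [Set.mem_insert_iff, Set.mem_singleton_iff, Prod.mk.injEq] at hmem
    have key : (P.pairingIn ℤ i j = 2 ∧ P.pairingIn ℤ j i = 2) ∨
        (P.pairingIn ℤ i j = -2 ∧ P.pairingIn ℤ j i = -2) ∨
        (P.pairingIn ℤ i j = 1 ∧ P.pairingIn ℤ j i = 4) ∨
        (P.pairingIn ℤ j i = 1 ∧ P.pairingIn ℤ i j = 4) ∨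
        (P.pairingIn ℤ i j = -1 ∧ P.pairingIn ℤ j i = -4) ∨
        (P.pairingIn ℤ j i = -1 ∧ P.pairingIn ℤ i j = -4) := by
      generalize P.pairingIn ℤ i j = a at *
      generalize P.pairingIn ℤ j i = b at *
      rcases hmem with h | h | h | h | h | h | h | h | h | h | h | h | h | h | h | h | h <;>
        obtain ⟨rfl, rfl⟩ := h <;> revert h4 <;> decide
    rcases key with h | h | h | h | h | h
    · exact Or.inl (congrArg P.root ((P.pairingIn_two_two_iff ℤ _ _).1 h))
    · exact Or.inr ((P.pairingIn_neg_two_neg_two_iff ℤ _ _).1 h)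
    · exact absurd ((P.pairingIn_one_four_iff ℤ _ _).1 h) (j.2 i)
    · exact absurd ((P.pairingIn_one_four_iff ℤ _ _).1 h) (i.2 j)
    · exact absurd (((P.pairingIn_neg_one_neg_four_iff ℤ _ _).1 h).trans
        (neg_two_smul_root_eq P i)) (j.2 _)
    · exact absurd (((P.pairingIn_neg_one_neg_four_iff ℤ _ _).1 h).trans
        (neg_two_smul_root_eq P j)) (i.2 _)

instance [P.IsRootSystem] : (indivisible P).IsRootSystem := by
  have h : (indivisible P).rootSpan ℝ = ⊤ := by
    rw [eq_top_iff, ← RootPairing.IsRootSystem.span_root_eq_top (P := P), Submodule.span_le]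
    rintro _ ⟨i, rfl⟩
    by_cases hi : ∀ j, P.root i ≠ (2 : ℝ) • P.root j
    · exact Submodule.subset_span ⟨⟨i, hi⟩, rfl⟩
    · push Not at hi
      obtain ⟨j, hj⟩ := hi
      rw [hj]
      exact Submodule.smul_mem _ _
        (Submodule.subset_span ⟨⟨j, indivisible_of_root_eq_two_smul P hj⟩, rfl⟩)
  have := Fintype.ofFinite {i // ∀ j, P.root i ≠ (2 : ℝ) • P.root j}
  exact ⟨h, (indivisible P).rootSpan_eq_top_iff.1 h⟩

/-- The root lattice of a possibly non-reduced root system has a basis consisting of roots such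
that all indivisible roots are obtained from it by simple reflections and signs. -/
theorem exists_latticeBasis [P.IsRootSystem] :
    ∃ (κ : Type u) (k : κ → ι) (b : Module.Basis κ ℤ (P.rootSpan ℤ)),
    (∀ j, b j = P.rootSpanMem ℤ (k j)) ∧
    ∀ p : ι → Prop, (∀ j, p (k j)) → (∀ i, p i → p (P.reflectionPerm i i)) →
      (∀ i j, p i → p (P.reflectionPerm (k j) i)) →
      ∀ i, (∀ j, P.root i ≠ (2 : ℝ) • P.root j) → p i := by
  obtain ⟨B⟩ := (indivisible P).nonempty_base
  have hspan : (indivisible P).rootSpan ℤ = P.rootSpan ℤ := by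
    refine le_antisymm (Submodule.span_mono ?_) (Submodule.span_le.2 ?_)
    · rintro _ ⟨i, rfl⟩
      exact ⟨i, rfl⟩
    · rintro _ ⟨i, rfl⟩
      by_cases hi : ∀ j, P.root i ≠ (2 : ℝ) • P.root j
      · exact Submodule.subset_span ⟨⟨i, hi⟩, rfl⟩
      · push Not at hi
        obtain ⟨j, hj⟩ := hi
        rw [hj, two_smul]
        have : P.root j ∈ (indivisible P).rootSpan ℤ :=
          Submodule.subset_span ⟨⟨j, indivisible_of_root_eq_two_smul P hj⟩, rfl⟩
        exact add_mem this this
  refine ⟨B.support, fun j => j, B.toWeightBasisInt.map (LinearEquiv.ofEq _ _ hspan),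
    fun j => ?_, fun p h1 h2 h3 i hi => ?_⟩
  · exact Subtype.ext (B.coe_toWeightBasisInt_apply j)
  · exact B.induction_reflect ⟨i, hi⟩ (p := fun i => p i) (fun i => h2 i) (fun i hi => h1 ⟨i, hi⟩)
      (fun i j hi hj => h3 i ⟨j, hj⟩ hi)

end Indivisible

/-! ### The section of the reduction and the lattice of shifts -/

section Discrete

/-- If `X` is discrete and contains the translates `x + 2a` for `a` in a subgroup `A`, then `A` is
finitely generated. -/
lemma fg_of_translates_mem {V : Type*} [AddCommGroup V] [Module ℂ V] [FiniteDimensional ℂ V]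
    {X : Set V} (hX : @IsDiscrete _ (moduleTopology ℂ V) X) (A : Submodule ℤ V) (x : V)
    (hA : ∀ a ∈ A, x + (2 : ℤ) • a ∈ X) : A.FG := by
  let _ : TopologicalSpace V := moduleTopology ℂ V
  have : IsModuleTopology ℂ V := ⟨rfl⟩
  have : ContinuousAdd V := IsModuleTopology.toContinuousAdd ℂ V
  let e := (Module.finBasis ℂ V).equivFun
  let e' : V →ₗ[ℤ] (Fin (Module.finrank ℂ V) → ℂ) := e.toLinearMap.restrictScalars ℤ
  have he' : Function.Injective e' := e.injective
  have he : Continuous e.symm.toLinearMap := IsModuleTopology.continuous_of_linearMap _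
  have hmem : ∀ l : A.map e', x + (e.symm l + e.symm l) ∈ X := by
    rintro ⟨_, a, ha, rfl⟩
    have := hA a ha
    rw [two_smul] at this
    change x + (e.symm (e a) + e.symm (e a)) ∈ X
    rwa [e.symm_apply_apply]
  have := hX.to_subtype
  have : DiscreteTopology (A.map e') := by
    refine DiscreteTopology.of_continuous_injective (f := fun l => (⟨_, hmem l⟩ : X)) ?_ ?_
    · have h1 : Continuous fun l : A.map e' => e.symm (l : Fin (Module.finrank ℂ V) → ℂ) :=
        he.comp continuous_subtype_val
      exact (continuous_const.add (h1.add h1)).subtype_mk _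
    · intro l m h
      have h1 : e.symm (l : Fin (Module.finrank ℂ V) → ℂ) + e.symm (l : Fin (Module.finrank ℂ V) → ℂ) =
          e.symm (m : Fin (Module.finrank ℂ V) → ℂ) + e.symm (m : Fin (Module.finrank ℂ V) → ℂ) :=
        add_left_cancel (congrArg Subtype.val h)
      rw [← two_smul ℂ, ← two_smul ℂ] at h1
      exact Subtype.ext (e.symm.injective (smul_right_injective V (two_ne_zero' ℂ) h1))
  have : Module.Finite ℤ (A.map e') := instModuleFinite_of_discrete_submodule _
  exact Submodule.fg_of_fg_map_injective e' he' (Module.Finite.iff_fg.1 this)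

end Discrete

section Lattice

open Module

variable {E : Type*} [AddCommGroup E] [Module ℂ E] {C : Set (Dual ℂ E)} {cr : Dual ℂ E → E}
  {M : Type*} [AddCommGroup M] {ρ : AddSubgroup.closure C →+ M}

/-- The reduction to the root lattice has a section which takes indivisible roots into `C`: lift a
base, and use that the reflections lift. -/
lemma IsRootSet.exists_section [Module ℝ M] {ι : Type*} {P : RootPairing ι ℝ M (Dual ℝ M)}
    [Finite ι] [P.IsCrystallographic] [P.IsRootSystem]
    (hC : IsRootSet C cr)
    (hsurj : ∀ i, ∃ φ : AddSubgroup.closure C, (φ : Dual ℂ E) ∈ C ∧ ρ φ = P.root i)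
    (hpair : ∀ (α : AddSubgroup.closure C) (i : ι), (α : Dual ℂ E) ∈ C → ρ α = P.root i →
        ∀ φ : AddSubgroup.closure C,
          ((P.coroot' i (ρ φ) : ℝ) : ℂ) = (φ : Dual ℂ E) (cr α)) :
    ∃ s : P.rootSpan ℤ →+ AddSubgroup.closure C, (∀ q, ρ (s q) = q) ∧
      ∀ i, (∀ j, P.root i ≠ (2 : ℝ) • P.root j) → (s (P.rootSpanMem ℤ i) : Dual ℂ E) ∈ C := by
  obtain ⟨κ, k, b, hb, hind⟩ := exists_latticeBasis P
  choose a ha hρa using fun j => hsurj (k j)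
  let s : P.rootSpan ℤ →ₗ[ℤ] AddSubgroup.closure C := b.constr ℤ a
  have hs : ∀ j, s (P.rootSpanMem ℤ (k j)) = a j := fun j => by rw [← hb, b.constr_basis]
  have hρs : ∀ q, ρ (s q) = q := by
    have : ρ.toIntLinearMap ∘ₗ s = (P.rootSpan ℤ).subtype :=
      b.ext fun j => by
        simp only [LinearMap.comp_apply, hb, hs, Submodule.subtype_apply]
        exact hρa j
    exact fun q => LinearMap.congr_fun this q
  refine ⟨s.toAddMonoidHom, hρs, hind _ (fun j => ?_) (fun i hi => ?_) fun i j hi => ?_⟩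
  · change ((s (P.rootSpanMem ℤ (k j)) : AddSubgroup.closure C) : Dual ℂ E) ∈ C
    rw [hs]; exact ha j
  · rw [P.rootSpanMem_reflectionPerm_self, map_neg]
    exact hC.neg_mem hi
  · obtain ⟨z, hz⟩ := P.exists_value (S := ℤ) i (k j)
    have hz' : P.coroot' (k j) (P.root i) = z := by rw [P.root_coroot'_eq_pairing, ← hz]; rfl
    have h1 : P.rootSpanMem ℤ (P.reflectionPerm (k j) i) =
        P.rootSpanMem ℤ i - z • P.rootSpanMem ℤ (k j) := by
      refine Subtype.ext ?_
      change P.root (P.reflectionPerm (k j) i) = _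
      rw [P.root_reflectionPerm, P.reflection_apply, hz', Int.cast_smul_eq_zsmul]
      rfl
    have h2 : s (P.rootSpanMem ℤ i - z • P.rootSpanMem ℤ (k j)) =
        s (P.rootSpanMem ℤ i) - z • a j := by rw [map_sub, map_zsmul, hs]
    have h3 := hpair _ _ (ha j) (hρa j) (s (P.rootSpanMem ℤ i))
    rw [hρs, hz'] at h3
    rw [h1]
    change ((s (P.rootSpanMem ℤ i - z • P.rootSpanMem ℤ (k j)) : AddSubgroup.closure C) :
      Dual ℂ E) ∈ C
    rw [h2]
    exact hC.reflection_mem_int (ha j) hi (by simpa using h3.symm)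

/-- The shifts `l` in the kernel of the reduction with `α + l ∈ C`. -/
def shifts (ρ : AddSubgroup.closure C →+ M) (α : AddSubgroup.closure C) :
    Set (AddSubgroup.closure C) := {l | ρ l = 0 ∧ ((α + l : AddSubgroup.closure C) : Dual ℂ E) ∈ C}

/-- Composing the reflections in `α + l` and `α` translates the elements `α + m` of `C` by `2 l` or
`-2 l`, according to the order; hence the shifts of `α` are stable under translation by twice the
group they generate. -/
lemma IsRootSet.add_two_smul_mem_shifts (hC : IsRootSet C cr)
    (hker : ∀ l : AddSubgroup.closure C, ρ l = 0 → ∀ γ ∈ C, (l : Dual ℂ E) (cr γ) = 0)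
    {α : AddSubgroup.closure C} (hα : (α : Dual ℂ E) ∈ C)
    {l : AddSubgroup.closure C} (hl : l ∈ Submodule.span ℤ (shifts ρ α)) :
    ∀ m ∈ shifts ρ α, m + (2 : ℤ) • l ∈ shifts ρ α ∧ m - (2 : ℤ) • l ∈ shifts ρ α := by
  rw [← Submodule.mem_toAddSubgroup, Submodule.span_int_eq_addSubgroupClosure] at hl
  induction hl using AddSubgroup.closure_induction with
  | mem l hl =>
    rintro m ⟨hm0, hm⟩
    obtain ⟨hl0, hl⟩ := hl
    have h1 : ((α + l : AddSubgroup.closure C) : Dual ℂ E) (cr (α : Dual ℂ E)) = 2 := by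
      simp [hC.apply_self _ hα, hker l hl0 _ hα]
    have h2 := hC.apply_self _ hl
    have h3 : (α : Dual ℂ E) (cr ((α + l : AddSubgroup.closure C) : Dual ℂ E)) = 2 := by
      rw [AddSubgroup.coe_add, LinearMap.add_apply, ← AddSubgroup.coe_add, hker l hl0 _ hl,
        add_zero] at h2
      exact h2
    have h4 : ((α + m : AddSubgroup.closure C) : Dual ℂ E) (cr (α : Dual ℂ E)) = (2 : ℤ) := by
      simp [hC.apply_self _ hα, hker m hm0 _ hα]
    have h5 : ((α + m : AddSubgroup.closure C) : Dual ℂ E)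
        (cr ((α + l : AddSubgroup.closure C) : Dual ℂ E)) = (2 : ℤ) := by
      rw [AddSubgroup.coe_add, LinearMap.add_apply, h3, hker m hm0 _ hl]; simp
    refine ⟨⟨by simp [hm0, hl0], ?_⟩, ⟨by simp [hm0, hl0], ?_⟩⟩
    · have h6 := hC.reflection_mem_int hα hm h4
      have h7 := hC.reflection_mem_int hl h6 (p := -2) (by
        rw [LinearMap.sub_apply, h5, LinearMap.smul_apply, h3]; norm_num)
      convert h7 using 1
      push_cast
      module
    · have h6 := hC.reflection_mem_int hl hm h5
      have h7 := hC.reflection_mem_int hα h6 (p := -2) (by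
        rw [LinearMap.sub_apply, h4, LinearMap.smul_apply, h1]; norm_num)
      convert h7 using 1
      push_cast
      module
  | zero => intro m hm; simpa using hm
  | add l l' _ _ h h' =>
    intro m hm
    have h1 := (h' _ (h m hm).1).1
    have h2 := (h' _ (h m hm).2).2
    constructor
    · convert h1 using 1; module
    · convert h2 using 1; module
  | neg l _ h =>
    intro m hm
    have := h m hm
    simpa [smul_neg, sub_neg_eq_add, ← sub_eq_add_neg] using this.symm

lemma IsRootSet.fg_span_shifts [FiniteDimensional ℂ E] (hC : IsRootSet C cr)
    (hd : @IsDiscrete _ (moduleTopology ℂ (Dual ℂ E)) C)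
    (hker : ∀ l : AddSubgroup.closure C, ρ l = 0 → ∀ γ ∈ C, (l : Dual ℂ E) (cr γ) = 0)
    {α : AddSubgroup.closure C} (hα : (α : Dual ℂ E) ∈ C) :
    (Submodule.span ℤ (shifts ρ α)).FG := by
  let i : AddSubgroup.closure C →ₗ[ℤ] Dual ℂ E := (AddSubgroup.closure C).subtype.toIntLinearMap
  refine Submodule.fg_of_fg_map_injective i Subtype.val_injective
    (fg_of_translates_mem hd _ α ?_)
  rintro _ ⟨l, hl, rfl⟩
  have h := (hC.add_two_smul_mem_shifts hker hα hl 0 ⟨map_zero ρ, by simpa using hα⟩).1.2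
  rw [zero_add] at h
  exact h

end Lattice

open Module

/-! ### The type of a discrete connected set of roots -/

/-- The type `(P, Λ)` of a connected set of roots `C`: an embedding `σ` of the
degree group `⟨P⟩ × Λ` in the dual of `E`, under which the elements of `C` have degrees
`(root, l)`. -/
structure IsTypeOf {E : Type*} [AddCommGroup E] [Module ℂ E] (C : Set (Dual ℂ E))
    (cr : Dual ℂ E → E) {ι M N : Type*} [AddCommGroup M] [Module ℝ M] [AddCommGroup N] [Module ℝ N]
    (P : RootPairing ι ℝ M N) {Λ : Type*} [AddCommGroup Λ]
    (σ : P.rootSpan ℤ × Λ →+ Dual ℂ E) : Prop where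
  injective : Function.Injective σ
  exists_eq : ∀ α ∈ C, ∃ i l, σ (P.rootSpanMem ℤ i, l) = α
  exists_mem : ∀ i, ∃ l, σ (P.rootSpanMem ℤ i, l) ∈ C
  exists_root : ∀ q l, σ (q, l) ∈ C → ∃ i, q = P.rootSpanMem ℤ i
  mem_of_indivisible : ∀ i, (∀ j, P.root i ≠ (2 : ℝ) • P.root j) → σ (P.rootSpanMem ℤ i, 0) ∈ C
  apply_coroot : ∀ i l, σ (P.rootSpanMem ℤ i, l) ∈ C → ∀ q m,
    σ (q, m) (cr (σ (P.rootSpanMem ℤ i, l))) = ((P.coroot' i (q : M) : ℝ) : ℂ)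
  closure_eq_top : AddSubgroup.closure {l | ∃ i, σ (P.rootSpanMem ℤ i, l) ∈ C} = ⊤

/-- Every discrete connected set of roots has a type `(P, ℤ ^ r)`. -/
theorem IsConnectedRootSet.exists_type {E : Type*} [AddCommGroup E] [Module ℂ E]
    [FiniteDimensional ℂ E] {C : Set (Dual ℂ E)} {cr : Dual ℂ E → E}
    (hC : IsConnectedRootSet C cr) (hd : @IsDiscrete _ (moduleTopology ℂ (Dual ℂ E)) C) :
    ∃ (ι M : Type) (_ : AddCommGroup M) (_ : Module ℝ M) (P : RootPairing ι ℝ M (Dual ℝ M))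
      (r : ℕ) (σ : P.rootSpan ℤ × (Fin r → ℤ) →+ Dual ℂ E),
      Finite ι ∧ P.IsRootSystem ∧ P.IsCrystallographic ∧ P.IsIrreducible ∧ IsTypeOf C cr P σ := by
  obtain ⟨ι, M, _, _, P, ρ, hι, hP, hcr, hirr, hroot, hsurj, hpair⟩ := hC.exists_rootPairing
  obtain ⟨s, hρs, hs⟩ := hC.exists_section hsurj hpair
  have hker : ∀ l : AddSubgroup.closure C, ρ l = 0 → ∀ γ ∈ C, (l : Dual ℂ E) (cr γ) = 0 := by
    intro l hl γ hγ
    obtain ⟨i, hi⟩ := hroot ⟨γ, AddSubgroup.subset_closure hγ⟩ hγ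
    rw [← hpair ⟨γ, AddSubgroup.subset_closure hγ⟩ i hγ hi l, hl, map_zero, Complex.ofReal_zero]
  -- the lattice generated by all shifts
  let S : ι → Set (AddSubgroup.closure C) := fun i => shifts ρ (s (P.rootSpanMem ℤ i))
  have hfg : ∀ i, (Submodule.span ℤ (S i)).FG := by
    intro i
    by_cases hi : ∀ j, P.root i ≠ (2 : ℝ) • P.root j
    · exact hC.fg_span_shifts hd hker (hs i hi)
    push Not at hi
    obtain ⟨j, hj⟩ := hi
    have hj' := hs j (indivisible_of_root_eq_two_smul P hj)
    have hFG := hC.fg_span_shifts hd hker hj'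
    have := isNoetherian_of_fg_of_noetherian _ hFG
    refine Submodule.FG.of_le hFG (Submodule.span_le.2 ?_)
    rintro l ⟨hl0, hl⟩
    have h2 : P.rootSpanMem ℤ i = (2 : ℤ) • P.rootSpanMem ℤ j := by
      refine Subtype.ext ?_
      change P.root i = (2 : ℤ) • P.root j
      rw [hj, ← Int.cast_smul_eq_zsmul ℝ]
      norm_num
    set a := s (P.rootSpanMem ℤ j)
    have hsi : s (P.rootSpanMem ℤ i) = (2 : ℤ) • a := by rw [h2, map_zsmul]
    rw [hsi] at hl
    -- reflecting `a` in `2 a + l` gives `-(a + l)`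
    have h3 := hC.apply_self _ hl
    have h4 : (a : Dual ℂ E) (cr (((2 : ℤ) • a + l : AddSubgroup.closure C) : Dual ℂ E)) =
        (1 : ℤ) := by
      rw [AddSubgroup.coe_add, LinearMap.add_apply, ← AddSubgroup.coe_add, hker l hl0 _ hl,
        add_zero, AddSubgroup.coe_zsmul, LinearMap.smul_apply, zsmul_eq_mul] at h3
      push_cast at h3 ⊢
      linear_combination h3 / 2
    have h5 := hC.neg_mem (hC.reflection_mem_int hl hj' h4)
    refine Submodule.subset_span ⟨hl0, ?_⟩
    convert h5 using 1
    push_cast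
    module
  let Λ : Submodule ℤ (AddSubgroup.closure C) := ⨆ i, Submodule.span ℤ (S i)
  have hΛ : Λ.FG := Submodule.fg_iSup _ hfg
  have hΛ0 : ∀ l ∈ Λ, ρ l = 0 := by
    have : Λ ≤ LinearMap.ker ρ.toIntLinearMap :=
      iSup_le fun i => Submodule.span_le.2 fun l hl => hl.1
    exact fun l hl => this hl
  have : Module.Finite ℤ Λ := Module.Finite.iff_fg.2 hΛ
  have : Module.IsTorsionFree ℤ (Dual ℂ E) := inferInstance
  have : Module.IsTorsionFree ℤ (AddSubgroup.closure C) :=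
    Function.Injective.moduleIsTorsionFree _ Subtype.val_injective fun _ _ => rfl
  let e := (Module.finBasis ℤ Λ).equivFun
  let τ : P.rootSpan ℤ × (Fin (finrank ℤ Λ) → ℤ) →+ AddSubgroup.closure C :=
    s.coprod (Λ.subtype.toAddMonoidHom.comp e.symm.toLinearMap.toAddMonoidHom)
  have hτ : ∀ q l, τ (q, l) = s q + (e.symm l : Λ) := fun q l => rfl
  have hρτ : ∀ q l, ρ (τ (q, l)) = q := fun q l => by
    rw [hτ, map_add, hρs, hΛ0 _ (e.symm l).2, add_zero]
  have hcases : ∀ α : AddSubgroup.closure C, (α : Dual ℂ E) ∈ C →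
      ∃ i, ∃ h : α - s (P.rootSpanMem ℤ i) ∈ Λ, τ (P.rootSpanMem ℤ i, e ⟨_, h⟩) = α := by
    intro α hα
    obtain ⟨i, hi⟩ := hroot α hα
    refine ⟨i, le_iSup (fun i => Submodule.span ℤ (S i)) i (Submodule.subset_span ⟨?_, ?_⟩), ?_⟩
    · rw [map_sub, hρs, hi, sub_self]
    · rwa [add_sub_cancel]
    · rw [hτ, e.symm_apply_apply, add_sub_cancel]
  refine ⟨ι, M, _, _, P, _, (AddSubgroup.closure C).subtype.comp τ, hι, hP, hcr, hirr, ?_, ?_, ?_,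
    ?_, ?_, ?_, ?_⟩
  · refine Subtype.val_injective.comp ((injective_iff_map_eq_zero τ).2 ?_)
    rintro ⟨q, l⟩ h
    have hq : q = 0 := Subtype.ext (by rw [← hρτ q l, h, map_zero]; rfl)
    subst hq
    rw [hτ, map_zero, zero_add] at h
    have hl : e.symm l = 0 := Subtype.ext h
    rw [e.symm.map_eq_zero_iff.1 hl]
    rfl
  · intro α hα
    obtain ⟨i, h, hi⟩ := hcases ⟨α, AddSubgroup.subset_closure hα⟩ hα
    exact ⟨i, _, congrArg Subtype.val hi⟩
  · intro i
    obtain ⟨φ, hφ, hφi⟩ := hsurj i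
    obtain ⟨j, h, hj⟩ := hcases φ hφ
    have hij : j = i := by
      refine P.root.injective ?_
      rw [← hφi, ← hj, hρτ]
    subst hij
    refine ⟨_, (?_ : ((τ (P.rootSpanMem ℤ j, e ⟨_, h⟩) : AddSubgroup.closure C) : Dual ℂ E) ∈ C)⟩
    rwa [hj]
  · intro q l h
    obtain ⟨i, hi⟩ := hroot (τ (q, l)) h
    exact ⟨i, Subtype.ext (by rw [← hρτ q l, hi])⟩
  · intro i hi
    have h : τ (P.rootSpanMem ℤ i, 0) = s (P.rootSpanMem ℤ i) := by
      rw [hτ, map_zero]; exact add_zero _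
    change (τ (P.rootSpanMem ℤ i, 0) : Dual ℂ E) ∈ C
    rw [h]
    exact hs i hi
  · intro i l h q m
    have h1 := hpair (τ (P.rootSpanMem ℤ i, l)) i h (hρτ _ _) (τ (q, m))
    rw [hρτ] at h1
    exact h1.symm
  · rw [eq_top_iff]
    have key : Λ ≤ (Submodule.comap e.toLinearMap (Submodule.span ℤ
        {l | ∃ i, (AddSubgroup.closure C).subtype.comp τ (P.rootSpanMem ℤ i, l) ∈ C})).map
          Λ.subtype := by
      refine iSup_le fun i => Submodule.span_le.2 fun l hl => ?_
      have hlΛ : l ∈ Λ := le_iSup (fun i => Submodule.span ℤ (S i)) i (Submodule.subset_span hl)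
      refine ⟨⟨l, hlΛ⟩, Submodule.subset_span ⟨i, ?_⟩, rfl⟩
      change (τ (P.rootSpanMem ℤ i, e ⟨l, hlΛ⟩) : Dual ℂ E) ∈ C
      rw [hτ, e.symm_apply_apply]
      exact hl.2
    intro l _
    obtain ⟨x, hx, hxl⟩ := key (e.symm l).2
    rw [show x = e.symm l from Subtype.ext hxl] at hx
    have hx' : e (e.symm l) ∈ Submodule.span ℤ
        {l | ∃ i, (AddSubgroup.closure C).subtype.comp τ (P.rootSpanMem ℤ i, l) ∈ C} := hx
    rwa [e.apply_symm_apply, ← Submodule.mem_toAddSubgroup,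
      Submodule.span_int_eq_addSubgroupClosure] at hx'

namespace IsGRLA

variable {G : Type*} [LieRing G] [LieAlgebra ℂ G] {form : LinearMap.BilinForm ℂ G}
  {H : LieSubalgebra ℂ G} (hG : IsGRLA form H)

/-! ### Components of the set of non-isotropic roots -/

section Components

include hG in
/-- Reflection-stable sets of non-isotropic roots satisfy the axioms of a root set. -/
lemma isRootSet {C : Set (Dual ℂ H)} (hC : C ⊆ nonisotropicRoots form H)
    (hr : ∀ α ∈ C, ∀ β ∈ C, β - β (hG.coroot α) • α ∈ C) : IsRootSet C hG.coroot where
  apply_self α hα := hG.apply_coroot_self (hC hα)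
  int α hα β hβ := by
    obtain ⟨p, hp⟩ := hG.exists_int (hC hα) (hG.mem_nonisotropicRoots.1 (hC hβ)).1
    exact ⟨p, hp, hG.abs_le_four (hC hα) (hC hβ) hp⟩
  reflection_mem := hr
  orthogonal_symm α hα β hβ h := by
    rwa [hG.ip_eq_zero_iff (hC hβ), hG.ip_comm, ← hG.ip_eq_zero_iff (hC hα)]
  coroot_eq_iff α hα β hβ := by
    have hα0 := (hG.mem_nonisotropicRoots.1 (hC hα)).2
    have hβ0 := (hG.mem_nonisotropicRoots.1 (hC hβ)).2
    simp only [hG.apply_coroot]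
    constructor
    · intro h γ hγ
      have h1 := h α hα
      have h2 := h β hβ
      have h3 := h γ hγ
      rw [hG.ip_comm β α] at h1
      rw [mul_div_assoc, div_self hα0, mul_one, eq_div_iff hβ0] at h1
      rw [mul_div_assoc, mul_div_assoc, div_self hβ0, mul_one, mul_div_assoc', div_eq_iff hα0]
        at h2
      have h4 : hG.ip α α = hG.ip β β := by linear_combination -(h1 + h2) / 2
      rw [h4, div_left_inj' hβ0] at h3
      rw [hG.ip_comm γ α, hG.ip_comm γ β, h3]
    · intro h γ hγ
      have key : ∀ δ ∈ C, hG.ip δ α = hG.ip δ β := by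
        intro δ hδ
        have := h δ hδ
        rw [div_left_inj' (hG.mem_nonisotropicRoots.1 (hC hδ)).2] at this
        linear_combination this / 2
      have h4 : hG.ip α α = hG.ip β β := by
        rw [key α hα, ← key β hβ, hG.ip_comm]
      rw [h4, hG.ip_comm α γ, hG.ip_comm β γ, key γ hγ]

/-- A component of the set of non-isotropic roots with respect to non-orthogonality. -/
structure IsComponent (C : Set (Dual ℂ H)) : Prop extends IsConnectedRootSet C hG.coroot where
  subset : C ⊆ nonisotropicRoots form H
  mem_of_ne_zero : ∀ α ∈ C, ∀ β ∈ nonisotropicRoots form H, β (hG.coroot α) ≠ 0 → β ∈ C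

/-- The equivalence relation on the non-isotropic roots generated by non-orthogonality. -/
def rootSetoid : Setoid (nonisotropicRoots form H) :=
  Relation.EqvGen.setoid fun α β => (β : Dual ℂ H) (hG.coroot α) ≠ 0

/-- The equivalence class of non-isotropic roots indexed by `q`. -/
def component (q : Quotient hG.rootSetoid) : Set (Dual ℂ H) :=
  {α | ∃ h : α ∈ nonisotropicRoots form H, Quotient.mk hG.rootSetoid ⟨α, h⟩ = q}

include hG in
lemma isRootSet_nonisotropicRoots : IsRootSet (nonisotropicRoots form H) hG.coroot :=
  hG.isRootSet subset_rfl fun _ hα _ hβ => hG.reflection_mem hα hβ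

lemma mem_component_of_ne_zero {q : Quotient hG.rootSetoid} {α β : Dual ℂ H}
    (hα : α ∈ hG.component q) (hβ : β ∈ nonisotropicRoots form H)
    (h : β (hG.coroot α) ≠ 0) : β ∈ hG.component q := by
  obtain ⟨hα', rfl⟩ := hα
  exact ⟨hβ, (Quotient.sound (s := hG.rootSetoid) (Relation.EqvGen.rel _ _ h)).symm⟩

lemma isComponent_component (q : Quotient hG.rootSetoid) : hG.IsComponent (hG.component q) where
  subset := fun _ h => h.1
  mem_of_ne_zero _ hα _ hβ h := hG.mem_component_of_ne_zero hα hβ h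
  nonempty := by
    obtain ⟨⟨α, hα⟩, rfl⟩ := Quotient.exists_rep q
    exact ⟨α, hα, rfl⟩
  toIsRootSet := by
    refine hG.isRootSet (fun _ h => h.1) fun α hα β hβ => ?_
    by_cases h : β (hG.coroot α) = 0
    · rwa [h, zero_smul, sub_zero]
    refine hG.mem_component_of_ne_zero hα (hG.reflection_mem hα.1 hβ.1) ?_
    rw [LinearMap.sub_apply, LinearMap.smul_apply, hG.apply_coroot_self hα.1, smul_eq_mul]
    intro hc
    exact h (by linear_combination -hc)
  eq_of_closed A hAC hA hcl := by
    refine hAC.antisymm ?_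
    obtain ⟨α, hα⟩ := hA
    rintro β ⟨hβ, hq⟩
    have key : ∀ x y : nonisotropicRoots form H, Relation.EqvGen
        (fun α β : nonisotropicRoots form H => (β : Dual ℂ H) (hG.coroot α) ≠ 0) x y →
        ((x : Dual ℂ H) ∈ A ↔ (y : Dual ℂ H) ∈ A) := by
      intro x y h
      induction h with
      | rel x y h =>
        have h' : (x : Dual ℂ H) (hG.coroot y) ≠ 0 := fun hc =>
          h (hG.isRootSet_nonisotropicRoots.orthogonal_symm _ y.2 _ x.2 hc)
        exact ⟨fun hx => hcl _ hx _ (hG.mem_component_of_ne_zero (hAC hx) y.2 h) h,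
          fun hy => hcl _ hy _ (hG.mem_component_of_ne_zero (hAC hy) x.2 h') h'⟩
      | refl x => rfl
      | symm x y _ ih => exact ih.symm
      | trans x y z _ _ ih1 ih2 => exact ih1.trans ih2
    obtain ⟨hα', hαq⟩ := hAC hα
    exact (key ⟨α, hα'⟩ ⟨β, hβ⟩ (Quotient.exact (s := hG.rootSetoid) (hαq.trans hq.symm))).1 hα

instance finite_components : Finite (Quotient hG.rootSetoid) := by
  have := hG.finiteDimensional
  have hX := hG.isRootSet_nonisotropicRoots
  obtain ⟨n, b, hb, hspan⟩ :=
    IsRootSet.exists_finite_spanning_coroots (nonisotropicRoots form H) hG.coroot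
  have hfin : Finite (IsRootSet.coord b hG.coroot '' nonisotropicRoots form H) :=
    hX.finite_coord_image hb
  refine Finite.of_surjective (α := IsRootSet.coord b hG.coroot '' nonisotropicRoots form H)
    (fun v => Quotient.mk hG.rootSetoid ⟨v.2.choose, v.2.choose_spec.1⟩) fun q => ?_
  obtain ⟨⟨α, hα⟩, rfl⟩ := Quotient.exists_rep q
  refine ⟨⟨_, α, hα, rfl⟩, ?_⟩
  have h : IsRootSet.coord b hG.coroot α ∈ IsRootSet.coord b hG.coroot '' nonisotropicRoots form H :=
    ⟨α, hα, rfl⟩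
  refine Quotient.sound (s := hG.rootSetoid) (Relation.EqvGen.rel _ _ ?_)
  change α (hG.coroot h.choose) ≠ 0
  -- roots with the same coordinates have the same pairings with coroots
  obtain ⟨f, hf⟩ := hX.exists_dual_coord hb hspan h.choose_spec.1
  rw [← hf α (AddSubgroup.subset_closure hα), ← h.choose_spec.2,
    hf _ (AddSubgroup.subset_closure h.choose_spec.1), hX.apply_self _ h.choose_spec.1]
  exact two_ne_zero

instance nonempty_components : Nonempty (Quotient hG.rootSetoid) := by
  obtain ⟨α, hα⟩ := hG.nonempty
  exact ⟨Quotient.mk _ ⟨α, hα⟩⟩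

include hG in
/-- Roots from different components do not add up to a root: their sum is orthogonal to neither
of them, so it would be non-isotropic and connect the two components. -/
lemma add_notMem_roots {q q' : Quotient hG.rootSetoid} (hne : q ≠ q') {α β : Dual ℂ H}
    (hα : α ∈ hG.component q) (hβ : β ∈ hG.component q') : α + β ∉ roots H := by
  intro hr
  have h0 : β (hG.coroot α) = 0 := by
    by_contra hc
    obtain ⟨hβ', h⟩ := hG.mem_component_of_ne_zero hα hβ.1 hc
    exact hne (h.symm.trans hβ.2)
  have h0' := hG.isRootSet_nonisotropicRoots.orthogonal_symm _ hα.1 _ hβ.1 h0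
  have h1 : (α + β) (hG.coroot α) = 2 := by
    rw [LinearMap.add_apply, hG.apply_coroot_self hα.1, h0, add_zero]
  have h2 : (α + β) (hG.coroot β) = 2 := by
    rw [LinearMap.add_apply, hG.apply_coroot_self hβ.1, h0', zero_add]
  by_cases hi : hG.ip (α + β) (α + β) = 0
  · have := hG.ip_eq_zero_of_isotropic hr hi hα.1
    rw [hG.ip_comm, ← hG.ip_eq_zero_iff hα.1, h1] at this
    exact two_ne_zero this
  · have hX := hG.mem_nonisotropicRoots.2 ⟨hr, hi⟩
    obtain ⟨_, h3⟩ := hG.mem_component_of_ne_zero hα hX (by rw [h1]; exact two_ne_zero)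
    obtain ⟨_, h4⟩ := hG.mem_component_of_ne_zero hβ hX (by rw [h2]; exact two_ne_zero)
    exact hne (h3.symm.trans h4)

end Components

/-! ### The homogeneous pieces of the core -/

section Pieces

/-- The piece of weight `γ` of the ideal of the core attached to a component `C`: the root space if
`γ ∈ C`, and spanned by brackets of two root vectors from `C` if `γ` is orthogonal to `C`. -/
def piece (C : Set (Dual ℂ H)) (γ : Dual ℂ H) : Submodule ℂ G :=
  Submodule.span ℂ {z | (γ ∈ C ∧ z ∈ rootSpace H γ) ∨ ((∀ δ ∈ C, γ (hG.coroot δ) = 0) ∧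
    ∃ α ∈ C, ∃ β ∈ C, ∃ x ∈ rootSpace H α, ∃ y ∈ rootSpace H β, α + β = γ ∧ ⁅x, y⁆ = z)}

variable {C : Set (Dual ℂ H)} {γ δ : Dual ℂ H} {x y : G}

lemma piece_le_rootSpace : hG.piece C γ ≤ rootSpace H γ := by
  refine Submodule.span_le.2 ?_
  rintro z (⟨-, hz⟩ | ⟨-, α, -, β, -, x, hx, y, hy, rfl, rfl⟩)
  · exact hz
  · exact lie_mem_rootSpace hx hy

lemma mem_piece (hγ : γ ∈ C) (hx : x ∈ rootSpace H γ) : x ∈ hG.piece C γ :=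
  Submodule.subset_span (Or.inl ⟨hγ, hx⟩)

variable {hG}

/-- A root which is not orthogonal to a component belongs to it; it is not isotropic, as isotropic
roots are orthogonal to the component. -/
lemma IsComponent.mem_of_apply_ne_zero (hC : hG.IsComponent C) (hδ : δ ∈ C)
    (h : γ (hG.coroot δ) ≠ 0) (hγ : γ ∈ roots H) : γ ∈ C := by
  refine hC.mem_of_ne_zero δ hδ γ (hG.mem_nonisotropicRoots.2 ⟨hγ, fun hi => h ?_⟩) h
  rw [hG.ip_eq_zero_iff (hC.subset hδ), hG.ip_comm]
  exact hG.ip_eq_zero_of_isotropic hγ hi (hC.subset hδ)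

lemma IsComponent.rootSpace_le_piece (hC : hG.IsComponent C) (hδ : δ ∈ C)
    (h : γ (hG.coroot δ) ≠ 0) : rootSpace H γ ≤ hG.piece C γ := by
  intro x hx
  by_cases hx0 : x = 0
  · rw [hx0]; exact zero_mem _
  · exact hG.mem_piece (hC.mem_of_apply_ne_zero hδ h (mem_roots_of_mem hx hx0)) hx

lemma IsComponent.lie_mem_piece (hC : hG.IsComponent C) (hx : x ∈ hG.piece C γ)
    (hy : y ∈ hG.piece C δ) : ⁅x, y⁆ ∈ hG.piece C (γ + δ) := by
  by_cases hort : ∃ ε ∈ C, (γ + δ) (hG.coroot ε) ≠ 0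
  · obtain ⟨ε, hε, h⟩ := hort
    exact hC.rootSpace_le_piece hε h
      (lie_mem_rootSpace (hG.piece_le_rootSpace hx) (hG.piece_le_rootSpace hy))
  push Not at hort
  have hne : ∀ α ∈ C, ∀ β, (∀ ε ∈ C, β (hG.coroot ε) = 0) → (α + β) (hG.coroot α) ≠ 0 := by
    intro α hα β hβ
    rw [LinearMap.add_apply, hC.apply_self α hα, hβ α hα, add_zero]
    exact two_ne_zero
  induction hx using Submodule.span_induction with
  | zero => rw [zero_lie]; exact zero_mem _
  | add x x' _ _ h1 h2 => rw [add_lie]; exact add_mem h1 h2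
  | smul a x _ h => rw [smul_lie]; exact Submodule.smul_mem _ _ h
  | mem x hx =>
    rcases hx with ⟨hγ, hx⟩ | ⟨hγ, α, hα, β, hβ, a, ha, b, hb, hs, rfl⟩
    · induction hy using Submodule.span_induction with
      | zero => rw [lie_zero]; exact zero_mem _
      | add y y' _ _ h1 h2 => rw [lie_add]; exact add_mem h1 h2
      | smul a y _ h => rw [lie_smul]; exact Submodule.smul_mem _ _ h
      | mem y hy =>
        rcases hy with ⟨hδ, hy⟩ | ⟨hδ, -⟩
        · exact Submodule.subset_span (Or.inr ⟨hort, γ, hγ, δ, hδ, x, hx, y, hy, rfl, rfl⟩)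
        · exact absurd (hort γ hγ) (hne γ hγ δ hδ)
    · -- here both weights are orthogonal to `C`, and the Jacobi identity applies
      have hδ : ∀ ε ∈ C, δ (hG.coroot ε) = 0 := fun ε hε => by
        have := hort ε hε
        rwa [LinearMap.add_apply, hγ ε hε, zero_add] at this
      have hy' := hG.piece_le_rootSpace hy
      have key : ∀ α ∈ C, ∀ β ∈ C, α + β + δ = γ + δ → ∀ a ∈ rootSpace H α,
          ∀ b ∈ rootSpace H β, ⁅a, ⁅b, y⁆⁆ ∈ hG.piece C (γ + δ) := by
        intro α hα β hβ hsum a ha b hb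
        have hby := lie_mem_rootSpace hb hy'
        by_cases h0 : ⁅b, y⁆ = 0
        · rw [h0, lie_zero]; exact zero_mem _
        · have hmem := hC.mem_of_apply_ne_zero hβ (hne β hβ δ hδ) (mem_roots_of_mem hby h0)
          exact Submodule.subset_span
            (Or.inr ⟨hort, α, hα, _, hmem, a, ha, _, hby, by rw [← hsum, add_assoc], rfl⟩)
      rw [lie_lie]
      exact sub_mem (key α hα β hβ (by rw [hs]) a ha b hb)
        (key β hβ α hα (by rw [← hs, add_comm β]) b hb a ha)

variable (hG)

/-- The subalgebra generated by the root spaces of `C`. -/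
def coreOf (H : LieSubalgebra ℂ G) (C : Set (Dual ℂ H)) : LieSubalgebra ℂ G :=
  LieSubalgebra.lieSpan ℂ G {x | ∃ α ∈ C, x ∈ rootSpace H α}

lemma piece_le_coreOf : hG.piece C γ ≤ (coreOf H C).toSubmodule := by
  refine Submodule.span_le.2 ?_
  rintro z (⟨hγ, hz⟩ | ⟨-, α, hα, β, hβ, x, hx, y, hy, rfl, rfl⟩)
  · exact LieSubalgebra.subset_lieSpan ⟨γ, hγ, hz⟩
  · exact (coreOf H C).lie_mem (LieSubalgebra.subset_lieSpan ⟨α, hα, hx⟩)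
      (LieSubalgebra.subset_lieSpan ⟨β, hβ, hy⟩)

lemma coreOf_component_le_core (q : Quotient hG.rootSetoid) :
    coreOf H (hG.component q) ≤ core form H :=
  LieSubalgebra.lieSpan_mono fun _ ⟨α, hα, hx⟩ => ⟨α, hα.1, hx⟩

lemma lie_eq_zero_of_mem_lieSpan {s t : Set G}
    (h : ∀ x ∈ s, ∀ y ∈ t, ⁅x, y⁆ = 0)
    {x y : G} (hx : x ∈ LieSubalgebra.lieSpan ℂ G s) (hy : y ∈ LieSubalgebra.lieSpan ℂ G t) :
    ⁅x, y⁆ = 0 := by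
  have h1 : ∀ x ∈ s, ⁅x, y⁆ = 0 := by
    intro x hxs
    induction hy using LieSubalgebra.lieSpan_induction with
    | mem y hy => exact h x hxs y hy
    | zero => rw [lie_zero]
    | add y z _ _ h1 h2 => rw [lie_add, h1, h2, add_zero]
    | smul a y _ h => rw [lie_smul, h, smul_zero]
    | lie y z _ _ h1 h2 => rw [leibniz_lie, h1, h2, zero_lie, lie_zero, add_zero]
  induction hx using LieSubalgebra.lieSpan_induction with
  | mem x hx => exact h1 x hx
  | zero => rw [zero_lie]
  | add x z _ _ h1 h2 => rw [add_lie, h1, h2, add_zero]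
  | smul a x _ h => rw [smul_lie, h, smul_zero]
  | lie x z _ _ h1 h2 => rw [lie_lie, h1, h2, lie_zero, lie_zero, sub_zero]

lemma lie_eq_zero_of_component_ne {q q' : Quotient hG.rootSetoid} (hne : q ≠ q')
    (hx : x ∈ coreOf H (hG.component q)) (hy : y ∈ coreOf H (hG.component q')) : ⁅x, y⁆ = 0 := by
  refine lie_eq_zero_of_mem_lieSpan ?_ hx hy
  rintro x ⟨α, hα, hx⟩ y ⟨β, hβ, hy⟩
  by_contra hc
  exact hG.add_notMem_roots hne hα hβ (mem_roots_of_mem (lie_mem_rootSpace hx hy) hc)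

/-- The core is the sum of its pieces. -/
lemma core_le_iSup_piece : (core form H).toSubmodule ≤ ⨆ q, ⨆ γ, hG.piece (hG.component q) γ := by
  intro x hx
  rw [LieSubalgebra.mem_toSubmodule] at hx
  induction hx using LieSubalgebra.lieSpan_induction with
  | mem x hx =>
    obtain ⟨α, hα, hx⟩ := hx
    refine Submodule.mem_iSup_of_mem (Quotient.mk hG.rootSetoid ⟨α, hα⟩)
      (Submodule.mem_iSup_of_mem α (hG.mem_piece ⟨hα, rfl⟩ hx))
  | zero => exact zero_mem _
  | add x y _ _ h1 h2 => exact add_mem h1 h2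
  | smul a x _ h => exact Submodule.smul_mem _ _ h
  | lie x y hx hy h1 h2 =>
    clear hx hy
    induction h1 using Submodule.iSup_induction' with
    | zero => rw [zero_lie]; exact zero_mem _
    | add x x' _ _ h h' => rw [add_lie]; exact add_mem h h'
    | mem q x hx =>
      induction h2 using Submodule.iSup_induction' with
      | zero => rw [lie_zero]; exact zero_mem _
      | add x x' _ _ h h' => rw [lie_add]; exact add_mem h h'
      | mem q' y hy =>
        by_cases hq : q = q'
        · subst hq
          refine Submodule.mem_iSup_of_mem q ?_
          induction hx using Submodule.iSup_induction' with
          | zero => rw [zero_lie]; exact zero_mem _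
          | add x x' _ _ h h' => rw [add_lie]; exact add_mem h h'
          | mem γ x hx =>
            induction hy using Submodule.iSup_induction' with
            | zero => rw [lie_zero]; exact zero_mem _
            | add x x' _ _ h h' => rw [lie_add]; exact add_mem h h'
            | mem δ y hy =>
              exact Submodule.mem_iSup_of_mem (γ + δ)
                ((hG.isComponent_component q).lie_mem_piece hx hy)
        · rw [hG.lie_eq_zero_of_component_ne hq
            (iSup_le (fun γ => hG.piece_le_coreOf) hx) (iSup_le (fun γ => hG.piece_le_coreOf) hy)]
          exact zero_mem _

end Pieces

end IsGRLA

/-! ### The core modulo its center -/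

section Quotient

variable {G : Type*} [LieRing G] [LieAlgebra ℂ G] {form : LinearMap.BilinForm ℂ G}
  {H : LieSubalgebra ℂ G}

/-- The projection of the core onto its quotient by the center. -/
def coreMk (form : LinearMap.BilinForm ℂ G) (H : LieSubalgebra ℂ G) :
    core form H →ₗ[ℂ] CoreModCenter form H :=
  (LieSubmodule.Quotient.mk' (LieAlgebra.center ℂ (core form H)) :
    core form H →ₗ[ℂ] CoreModCenter form H)

lemma coreMk_surjective : Function.Surjective (coreMk form H) :=
  LieSubmodule.Quotient.surjective_mk' _

lemma coreMk_lie (x y : core form H) : coreMk form H ⁅x, y⁆ = ⁅coreMk form H x, coreMk form H y⁆ :=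
  LieSubmodule.Quotient.mk_bracket _ x y

lemma coreMk_eq_zero {x : core form H} :
    coreMk form H x = 0 ↔ ∀ y ∈ core form H, ⁅(x : G), y⁆ = 0 := by
  have h1 : coreMk form H x = 0 ↔ x ∈ LieAlgebra.center ℂ (core form H) :=
    LieSubmodule.Quotient.mk_eq_zero _
  rw [h1, LieModule.mem_maxTrivSubmodule]
  refine ⟨fun h y hy => ?_, fun h y => Subtype.ext ?_⟩
  · have := congrArg Subtype.val (h ⟨y, hy⟩)
    rw [← lie_skew]
    exact neg_eq_zero.2 this
  · change ⁅(y : G), (x : G)⁆ = 0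
    rw [← lie_skew, h y y.2, neg_zero]

/-- Centrality in the core can be tested on root vectors. -/
lemma lie_eq_zero_of_rootSpace {x : G}
    (h : ∀ α ∈ nonisotropicRoots form H, ∀ y ∈ rootSpace H α, ⁅x, y⁆ = 0) :
    ∀ y ∈ core form H, ⁅x, y⁆ = 0 := by
  intro y hy
  refine IsGRLA.lie_eq_zero_of_mem_lieSpan (s := {x}) ?_
    (LieSubalgebra.subset_lieSpan (Set.mem_singleton x)) hy
  rintro _ rfl y ⟨α, hα, hy⟩
  exact h α hα y hy

/-- The image of a subspace of `G` in the core modulo its center. -/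
def coreImage (form : LinearMap.BilinForm ℂ G) (H : LieSubalgebra ℂ G) (p : Submodule ℂ G) :
    Submodule ℂ (CoreModCenter form H) :=
  (p.comap (core form H).toSubmodule.subtype).map (coreMk form H)

lemma mem_coreImage {p : Submodule ℂ G} {z : CoreModCenter form H} :
    z ∈ coreImage form H p ↔ ∃ x : core form H, (x : G) ∈ p ∧ coreMk form H x = z := Iff.rfl

lemma coreImage_mono {p q : Submodule ℂ G} (h : p ≤ q) :
    coreImage form H p ≤ coreImage form H q :=
  Submodule.map_mono (Submodule.comap_mono h)

lemma coreImage_iSup {ι : Type*} (p : ι → Submodule ℂ G)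
    (h : ∀ i, p i ≤ (core form H).toSubmodule) :
    coreImage form H (⨆ i, p i) = ⨆ i, coreImage form H (p i) := by
  refine le_antisymm ?_ (iSup_le fun i => coreImage_mono (le_iSup p i))
  rintro _ ⟨⟨x, hx⟩, hxp, rfl⟩
  replace hxp : x ∈ ⨆ i, p i := hxp
  induction hxp using Submodule.iSup_induction' with
  | mem i x hxi => exact Submodule.mem_iSup_of_mem i ⟨⟨x, hx⟩, hxi, rfl⟩
  | zero => exact (map_zero (coreMk form H)).symm ▸ zero_mem _
  | add x y hx' hy' h1 h2 =>
    have h3 := iSup_le h hx'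
    have h4 := iSup_le h hy'
    have := add_mem (h1 h3) (h2 h4)
    rwa [← map_add] at this

namespace IsGRLA

lemma mem_core {α : Dual ℂ H} (hα : α ∈ nonisotropicRoots form H) {x : G}
    (hx : x ∈ rootSpace H α) : x ∈ core form H :=
  LieSubalgebra.subset_lieSpan ⟨α, hα, hx⟩

variable (hG : IsGRLA form H)
include hG

/-- The core modulo its center has no center, because the core is perfect. -/
lemma eq_zero_of_lie_eq_zero (z : CoreModCenter form H)
    (hz : ∀ w : CoreModCenter form H, ⁅z, w⁆ = 0) :
    z = 0 := by
  obtain ⟨x, rfl⟩ := coreMk_surjective z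
  have h : ∀ y ∈ core form H, ∀ w ∈ core form H, ⁅⁅(x : G), y⁆, w⁆ = 0 := by
    intro y hy
    have := hz (coreMk form H ⟨y, hy⟩)
    rw [← coreMk_lie, coreMk_eq_zero] at this
    exact this
  refine coreMk_eq_zero.2 (lie_eq_zero_of_rootSpace fun α hα y hy => ?_)
  obtain ⟨e, he, f, hf, hef, -⟩ := hG.exists_rootSpace_eq_span hα
  have hcr : (hG.coroot α : G) ∈ core form H := by
    rw [← hef]
    exact (core form H).lie_mem (mem_core hα he)
      (mem_core (hG.neg_mem_nonisotropicRoots hα) hf)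
  have hyc := mem_core hα hy
  have h1 : ⁅(hG.coroot α : G), y⁆ = (2 : ℂ) • y := by
    rw [hG.lie_coroot hy, hG.apply_coroot_self hα]
  have h2 : (2 : ℂ) • ⁅(x : G), y⁆ = 0 := by
    rw [← lie_smul, ← h1, leibniz_lie, h _ hcr _ hyc, zero_add, ← lie_skew, h _ hyc _ hcr, neg_zero]
  exact (smul_eq_zero.1 h2).resolve_left two_ne_zero

/-- The weight spaces stay independent modulo the center of the core, since the homogeneous
components of a central element are central. -/
lemma iSupIndep_coreImage_rootSpace : iSupIndep fun γ => coreImage form H (rootSpace H γ) := by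
  rw [iSupIndep_iff_finsetSum_eq_zero_imp_eq_zero]
  intro s v hv hsum γ hγ
  choose! x hx hxv using fun γ (hγ : γ ∈ s) => mem_coreImage.1 (hv γ hγ)
  rw [← hxv γ hγ]
  refine coreMk_eq_zero.2 (lie_eq_zero_of_rootSpace fun α hα y hy => ?_)
  have h1 : coreMk form H (∑ γ ∈ s, x γ) = 0 := by
    rw [map_sum, ← hsum]
    exact Finset.sum_congr rfl hxv
  have h2 := coreMk_eq_zero.1 h1 y (mem_core hα hy)
  rw [AddSubmonoidClass.coe_finsetSum, sum_lie] at h2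
  have hind := hG.iSupIndep_rootSpace.comp (f := fun γ => γ + α) (add_left_injective α)
  rw [iSupIndep_iff_finsetSum_eq_zero_imp_eq_zero] at hind
  exact hind s (fun γ => ⁅(x γ : G), y⁆) (fun γ hγ => lie_mem_rootSpace (hx γ hγ) hy) h2 γ hγ

lemma piece_le_core (q : Quotient hG.rootSetoid) (γ : Dual ℂ H) :
    hG.piece (hG.component q) γ ≤ (core form H).toSubmodule :=
  (hG.piece_le_coreOf).trans (hG.coreOf_component_le_core q)

/-- The homogeneous piece of weight `γ` of the ideal of the core modulo its center attached to the
component `q`. -/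
def grade (q : Quotient hG.rootSetoid) (γ : Dual ℂ H) : Submodule ℂ (CoreModCenter form H) :=
  coreImage form H (hG.piece (hG.component q) γ)

lemma lie_mem_grade {q : Quotient hG.rootSetoid} {γ δ : Dual ℂ H} {x y : CoreModCenter form H}
    (hx : x ∈ hG.grade q γ) (hy : y ∈ hG.grade q δ) : ⁅x, y⁆ ∈ hG.grade q (γ + δ) := by
  obtain ⟨x, hx, rfl⟩ := hx
  obtain ⟨y, hy, rfl⟩ := hy
  exact ⟨⁅x, y⁆, (hG.isComponent_component q).lie_mem_piece hx hy, coreMk_lie x y⟩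

lemma lie_grade_eq_zero {q q' : Quotient hG.rootSetoid} (hne : q ≠ q') {γ δ : Dual ℂ H}
    {x y : CoreModCenter form H} (hx : x ∈ hG.grade q γ) (hy : y ∈ hG.grade q' δ) :
    ⁅x, y⁆ = 0 := by
  obtain ⟨x, hx, rfl⟩ := hx
  obtain ⟨y, hy, rfl⟩ := hy
  rw [← coreMk_lie, show ⁅x, y⁆ = 0 from Subtype.ext (hG.lie_eq_zero_of_component_ne hne
    (hG.piece_le_coreOf hx) (hG.piece_le_coreOf hy)), map_zero]

lemma iSup_grade : ⨆ q, ⨆ γ, hG.grade q γ = ⊤ := by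
  rw [eq_top_iff]
  intro z _
  obtain ⟨x, rfl⟩ := coreMk_surjective z
  have h := hG.core_le_iSup_piece x.2
  have h1 : coreMk form H x ∈ coreImage form H (⨆ q, ⨆ γ, hG.piece (hG.component q) γ) :=
    ⟨x, h, rfl⟩
  rw [coreImage_iSup _ fun q => iSup_le fun γ => hG.piece_le_core q γ] at h1
  simp only [coreImage_iSup _ fun γ => hG.piece_le_core _ γ] at h1
  exact h1

lemma lie_mem_iSup_grade {q : Quotient hG.rootSetoid} (x : CoreModCenter form H)
    {y : CoreModCenter form H} (hy : y ∈ ⨆ γ, hG.grade q γ) : ⁅x, y⁆ ∈ ⨆ γ, hG.grade q γ := by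
  have hx : x ∈ ⨆ q, ⨆ γ, hG.grade q γ := hG.iSup_grade ▸ Submodule.mem_top
  induction hx using Submodule.iSup_induction' with
  | zero => rw [zero_lie]; exact zero_mem _
  | add x x' _ _ h h' => rw [add_lie]; exact add_mem h h'
  | mem q' x hx =>
    induction hx using Submodule.iSup_induction' with
    | zero => rw [zero_lie]; exact zero_mem _
    | add x x' _ _ h h' => rw [add_lie]; exact add_mem h h'
    | mem γ x hx =>
      induction hy using Submodule.iSup_induction' with
      | zero => rw [lie_zero]; exact zero_mem _
      | add x x' _ _ h h' => rw [lie_add]; exact add_mem h h'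
      | mem δ y hy =>
        by_cases hq : q' = q
        · subst hq
          exact Submodule.mem_iSup_of_mem _ (hG.lie_mem_grade hx hy)
        · rw [hG.lie_grade_eq_zero hq hx hy]; exact zero_mem _

/-- The ideal of the core modulo its center attached to a component. -/
def ideal (q : Quotient hG.rootSetoid) : LieIdeal ℂ (CoreModCenter form H) where
  toSubmodule := ⨆ γ, hG.grade q γ
  lie_mem := fun {x _} hy => hG.lie_mem_iSup_grade x hy

lemma lie_ideal_eq_zero {q q' : Quotient hG.rootSetoid} (hne : q ≠ q')
    {x y : CoreModCenter form H} (hx : x ∈ hG.ideal q) (hy : y ∈ hG.ideal q') : ⁅x, y⁆ = 0 := by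
  replace hx : x ∈ ⨆ γ, hG.grade q γ := hx
  replace hy : y ∈ ⨆ γ, hG.grade q' γ := hy
  induction hx using Submodule.iSup_induction' with
  | zero => rw [zero_lie]
  | add x x' _ _ h h' => rw [add_lie, h, h', add_zero]
  | mem γ x hx =>
    induction hy using Submodule.iSup_induction' with
    | zero => rw [lie_zero]
    | add y y' _ _ h h' => rw [lie_add, h, h', add_zero]
    | mem δ y hy => exact hG.lie_grade_eq_zero hne hx hy

lemma eq_zero_of_lie_ideal_eq_zero {x : CoreModCenter form H}
    (h : ∀ q, ∀ y ∈ hG.ideal q, ⁅x, y⁆ = 0) : x = 0 := by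
  refine hG.eq_zero_of_lie_eq_zero x fun y => ?_
  have hy : y ∈ ⨆ q, ⨆ γ, hG.grade q γ := hG.iSup_grade ▸ Submodule.mem_top
  induction hy using Submodule.iSup_induction' with
  | zero => rw [lie_zero]
  | add y y' _ _ h h' => rw [lie_add, h, h', add_zero]
  | mem q y hy => exact h q y hy

/-- An element of one ideal which lies in the sum of the others commutes with everything. -/
lemma iSupIndep_ideal : iSupIndep fun q => (hG.ideal q).toSubmodule := by
  intro q
  rw [Submodule.disjoint_def]
  intro x hx hx'
  refine hG.eq_zero_of_lie_ideal_eq_zero fun q' y hy => ?_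
  by_cases hq : q = q'
  · subst hq
    have : ∀ q', ∀ hq' : q' ≠ q, (hG.ideal q').toSubmodule ≤
        LinearMap.ker (LieModule.toEnd ℂ (CoreModCenter form H) (CoreModCenter form H) y) :=
      fun q' hq' z hz => hG.lie_ideal_eq_zero hq'.symm hy hz
    have h := iSup₂_le this hx'
    rw [← lie_skew]
    exact neg_eq_zero.2 h
  · exact hG.lie_ideal_eq_zero hq hx hy

lemma center_ideal (q : Quotient hG.rootSetoid) : LieAlgebra.center ℂ (hG.ideal q) = ⊥ := by
  rw [LieSubmodule.eq_bot_iff]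
  rintro ⟨x, hx⟩ h
  rw [LieModule.mem_maxTrivSubmodule] at h
  refine Subtype.ext (hG.eq_zero_of_lie_ideal_eq_zero fun q' y hy => ?_)
  by_cases hq : q = q'
  · subst hq
    have := congrArg Subtype.val (h ⟨y, hy⟩)
    rw [← lie_skew]
    exact neg_eq_zero.2 this
  · exact hG.lie_ideal_eq_zero hq hx hy

end IsGRLA

end Quotient

/-! ### The ideals are Lie tori -/

namespace IsGRLA

variable {G : Type*} [LieRing G] [LieAlgebra ℂ G] {form : LinearMap.BilinForm ℂ G}
  {H : LieSubalgebra ℂ G} (hG : IsGRLA form H) {q : Quotient hG.rootSetoid} {α γ : Dual ℂ H}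

lemma grade_le_ideal : hG.grade q γ ≤ (hG.ideal q).toSubmodule := le_iSup (hG.grade q) γ

lemma iSupIndep_grade (q : Quotient hG.rootSetoid) : iSupIndep (hG.grade q) :=
  hG.iSupIndep_coreImage_rootSpace.mono fun _ => coreImage_mono hG.piece_le_rootSpace

/-- Each root of the component gives a one-dimensional piece and an `sl₂`-triple modulo the
center. -/
lemma exists_sl2_grade (hα : α ∈ hG.component q) :
    ∃ e ∈ hG.grade q α, ∃ f ∈ hG.grade q (-α), e ≠ 0 ∧
      (∀ x ∈ hG.grade q α, ∃ c : ℂ, x = c • e) ∧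
      ∀ γ, ∀ x ∈ hG.grade q γ, ⁅⁅e, f⁆, x⁆ = γ (hG.coroot α) • x := by
  have hC := hG.isComponent_component q
  obtain ⟨e, he, f, hf, hef, hspan⟩ := hG.exists_rootSpace_eq_span hα.1
  have hec := mem_core hα.1 he
  have hfc := mem_core (hG.neg_mem_nonisotropicRoots hα.1) hf
  refine ⟨coreMk form H ⟨e, hec⟩, ⟨⟨e, hec⟩, hG.mem_piece hα he, rfl⟩,
    coreMk form H ⟨f, hfc⟩, ⟨⟨f, hfc⟩, hG.mem_piece (hC.neg_mem hα) hf, rfl⟩, ?_, ?_, ?_⟩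
  · intro h0
    have h1 : (hG.coroot α : G) = 0 := by rw [← hef]; exact coreMk_eq_zero.1 h0 f hfc
    have h2 := hG.apply_coroot_self hα.1
    rw [show hG.coroot α = 0 from Subtype.ext h1, map_zero] at h2
    exact two_ne_zero h2.symm
  · rintro _ ⟨x, hx, rfl⟩
    obtain ⟨c, hc⟩ := hspan x (hG.piece_le_rootSpace hx)
    refine ⟨c, ?_⟩
    rw [← map_smul]
    exact congrArg _ (Subtype.ext hc)
  · rintro γ _ ⟨x, hx, rfl⟩
    rw [← coreMk_lie, ← coreMk_lie, ← map_smul]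
    refine congrArg _ (Subtype.ext ?_)
    change ⁅⁅e, f⁆, (x : G)⁆ = _
    have hx' : (x : G) ∈ rootSpace H γ := hG.piece_le_rootSpace hx
    rw [hef, hG.lie_coroot hx']
    rfl

/-- A nonzero piece has its weight in the component or orthogonal to it. -/
lemma mem_component_of_grade_ne_bot (h : hG.grade q γ ≠ ⊥) {δ : Dual ℂ H}
    (hδ : δ ∈ hG.component q) (h0 : γ (hG.coroot δ) ≠ 0) : γ ∈ hG.component q := by
  obtain ⟨_, ⟨x, hx, rfl⟩, hne⟩ := Submodule.exists_mem_ne_zero_of_ne_bot h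
  refine (hG.isComponent_component q).mem_of_apply_ne_zero hδ h0
    (mem_roots_of_mem (hG.piece_le_rootSpace hx) fun hx0 => hne ?_)
  rw [show x = 0 from Subtype.ext hx0, map_zero]

/-- Outside of the component, the pieces are spanned by brackets. -/
lemma grade_le_span (hγ : γ ∉ hG.component q) : hG.grade q γ ≤ Submodule.span ℂ
    {z | ∃ α ∈ hG.component q, ∃ β ∈ hG.component q, α + β = γ ∧
      ∃ x ∈ hG.grade q α, ∃ y ∈ hG.grade q β, ⁅x, y⁆ = z} := by
  rintro _ ⟨⟨x, hxc⟩, hx, rfl⟩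
  replace hx : x ∈ hG.piece (hG.component q) γ := hx
  induction hx using Submodule.span_induction with
  | zero => exact (map_zero (coreMk form H)).symm ▸ zero_mem _
  | add x y hx hy h1 h2 =>
    have := add_mem (h1 (hG.piece_le_core q γ hx)) (h2 (hG.piece_le_core q γ hy))
    rwa [← map_add] at this
  | smul a x hx h =>
    have := Submodule.smul_mem _ a (h (hG.piece_le_core q γ hx))
    rwa [← map_smul] at this
  | mem x hx =>
    obtain ⟨h, -⟩ | ⟨-, α, hα, β, hβ, a, ha, b, hb, hsum, rfl⟩ := hx
    · exact absurd h hγ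
    · exact Submodule.subset_span ⟨α, hα, β, hβ, hsum, _,
        ⟨⟨a, mem_core hα.1 ha⟩, hG.mem_piece hα ha, rfl⟩, _,
        ⟨⟨b, mem_core hβ.1 hb⟩, hG.mem_piece hβ hb, rfl⟩, (coreMk_lie _ _).symm⟩

section Torus

variable {ι M N : Type*} [AddCommGroup M] [Module ℝ M] [AddCommGroup N] [Module ℝ N]
  {P : RootPairing ι ℝ M N} {Λ : Type*} [AddCommGroup Λ] {σ : P.rootSpan ℤ × Λ →+ Dual ℂ H}

/-- The grading of the ideal attached to a component: the degree `(p, l)` stands for the weight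
`σ (p, l)`. -/
def torusGrade (q : Quotient hG.rootSetoid) (σ : P.rootSpan ℤ × Λ →+ Dual ℂ H)
    (p : P.rootSpan ℤ) (l : Λ) : Submodule ℂ (hG.ideal q) :=
  (hG.grade q (σ (p, l))).comap ((hG.ideal q).incl : hG.ideal q →ₗ[ℂ] CoreModCenter form H)

variable {hG}

variable (hσ : IsTypeOf (hG.component q) hG.coroot P σ)
include hσ

lemma isInternal_torusGrade [DecidableEq (P.rootSpan ℤ × Λ)] :
    DirectSum.IsInternal fun p : P.rootSpan ℤ × Λ => hG.torusGrade q σ p.1 p.2 := by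
  refine DirectSum.isInternal_submodule_of_iSupIndep_of_iSup_eq_top ?_ ?_
  · have hind := (hG.iSupIndep_grade q).comp hσ.injective
    rw [iSupIndep_iff_finsetSum_eq_zero_imp_eq_zero] at hind ⊢
    intro s v hv hsum p hp
    refine Subtype.ext (hind s (fun p => (v p : CoreModCenter form H)) hv ?_ p hp)
    rw [← AddSubmonoidClass.coe_finsetSum, hsum]
    rfl
  · have hle : (hG.ideal q).toSubmodule ≤ ⨆ p : P.rootSpan ℤ × Λ, hG.grade q (σ p) := by
      refine iSup_le fun γ => ?_
      by_cases hγ : γ ∈ hG.component q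
      · obtain ⟨i, l, rfl⟩ := hσ.exists_eq γ hγ
        exact le_iSup (fun p => hG.grade q (σ p)) _
      · refine (hG.grade_le_span hγ).trans (Submodule.span_le.2 ?_)
        rintro _ ⟨α, hα, β, hβ, -, x, hx, y, hy, rfl⟩
        obtain ⟨i, l, rfl⟩ := hσ.exists_eq α hα
        obtain ⟨j, m, rfl⟩ := hσ.exists_eq β hβ
        have := hG.lie_mem_grade hx hy
        rw [← map_add] at this
        exact Submodule.mem_iSup_of_mem _ this
    rw [eq_top_iff]
    rintro ⟨x, hx⟩ -
    have hx' := hle hx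
    induction hx' using Submodule.iSup_induction' with
    | mem p x h => exact Submodule.mem_iSup_of_mem p h
    | zero => exact zero_mem _
    | add x y h1 h2 h3 h4 =>
      have hle' : ⨆ p : P.rootSpan ℤ × Λ, hG.grade q (σ p) ≤ (hG.ideal q).toSubmodule :=
        iSup_le fun p => hG.grade_le_ideal
      exact add_mem (h3 (hle' h1)) (h4 (hle' h2))

lemma mem_component_of_torusGrade_ne_bot {i : ι} {l : Λ}
    (h : hG.torusGrade q σ (P.rootSpanMem ℤ i) l ≠ ⊥) :
    σ (P.rootSpanMem ℤ i, l) ∈ hG.component q := by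
  obtain ⟨m, hm⟩ := hσ.exists_mem i
  refine hG.mem_component_of_grade_ne_bot (fun hb => h ?_) hm ?_
  · rw [torusGrade, hb, Submodule.comap_bot]
    exact LinearMap.ker_eq_bot.2 Subtype.val_injective
  · rw [hσ.apply_coroot i m hm, P.root_coroot'_eq_pairing, P.pairing_same]
    norm_num

/-- The ideal attached to a component of type `(P, Λ)` is a Lie torus of this type. -/
theorem isLieTorusGrading [Finite ι] [P.IsRootSystem] :
    IsLieTorusGrading P (hG.torusGrade q σ) where
  isInternal := by
    classical
    exact isInternal_torusGrade hσ
  lie_mem p p' l m x hx y hy := by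
    have := hG.lie_mem_grade hx hy
    rw [← map_add] at this
    exact this
  support p l hp hpr := by
    by_contra hne
    have hb : hG.grade q (σ (p, l)) ≠ ⊥ := fun hb => hne (by
      rw [torusGrade, hb, Submodule.comap_bot]
      exact LinearMap.ker_eq_bot.2 Subtype.val_injective)
    obtain ⟨i, hi⟩ : ∃ i, P.coroot' i (p : M) ≠ 0 := by
      by_contra! hc
      exact hp (Subtype.ext (P.eq_zero_iff_forall_coroot'_eq_zero.2 hc))
    obtain ⟨m, hm⟩ := hσ.exists_mem i
    have h := hG.mem_component_of_grade_ne_bot hb hm (by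
      rw [hσ.apply_coroot i m hm]; exact_mod_cast hi)
    obtain ⟨j, hj⟩ := hσ.exists_root p l h
    exact hpr j hj
  rank_le_one i l := by
    by_cases h : hG.torusGrade q σ (P.rootSpanMem ℤ i) l = ⊥
    · rw [h, rank_bot]; exact zero_le_one
    obtain ⟨e, he, f, hf, -, hspan, -⟩ :=
      hG.exists_sl2_grade (mem_component_of_torusGrade_ne_bot hσ h)
    refine (rank_submodule_le_one_iff _).2 ⟨⟨e, hG.grade_le_ideal he⟩, he, fun x hx => ?_⟩
    obtain ⟨c, hc⟩ := hspan x hx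
    exact Submodule.mem_span_singleton.2 ⟨c, Subtype.ext hc.symm⟩
  rank_eq_one i hi := by
    obtain ⟨e, he, f, hf, h0, hspan, -⟩ := hG.exists_sl2_grade (hσ.mem_of_indivisible i hi)
    refine (rank_submodule_eq_one_iff _).2 ⟨⟨e, hG.grade_le_ideal he⟩, he, fun h => h0 ?_,
      fun x hx => ?_⟩
    · exact congrArg Subtype.val h
    · obtain ⟨c, hc⟩ := hspan x hx
      exact Submodule.mem_span_singleton.2 ⟨c, Subtype.ext hc.symm⟩
  exists_sl2 i l hr := by
    have hne : hG.torusGrade q σ (P.rootSpanMem ℤ i) l ≠ ⊥ := fun h => by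
      rw [h, rank_bot] at hr
      exact zero_ne_one hr
    have hmem := mem_component_of_torusGrade_ne_bot hσ hne
    obtain ⟨e, he, f, hf, -, -, hact⟩ := hG.exists_sl2_grade hmem
    have hf' : f ∈ hG.grade q (σ (-P.rootSpanMem ℤ i, -l)) := by
      rwa [← map_neg] at hf
    refine ⟨⟨e, hG.grade_le_ideal he⟩, he, ⟨f, hG.grade_le_ideal hf⟩, hf', fun p m x hx => ?_⟩
    refine Subtype.ext ?_
    rw [← hσ.apply_coroot i l hmem]
    exact hact _ x hx
  grade_zero l := by
    refine le_antisymm ?_ (Submodule.span_le.2 ?_)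
    · have h0 : σ (0, l) ∉ hG.component q := fun h => by
        obtain ⟨i, hi⟩ := hσ.exists_root 0 l h
        exact P.ne_zero i (congrArg Subtype.val hi).symm
      rintro ⟨x, hx⟩ hxg
      replace hxg : x ∈ hG.grade q (σ (0, l)) := hxg
      have h1 := hG.grade_le_span h0 hxg
      clear hxg
      have hle : Submodule.span ℂ {z | ∃ α ∈ hG.component q, ∃ β ∈ hG.component q,
          α + β = σ (0, l) ∧ ∃ x ∈ hG.grade q α, ∃ y ∈ hG.grade q β, ⁅x, y⁆ = z} ≤
          (hG.ideal q).toSubmodule := by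
        refine Submodule.span_le.2 ?_
        rintro _ ⟨α, -, β, -, -, x, hx, y, hy, rfl⟩
        exact hG.grade_le_ideal (hG.lie_mem_grade hx hy)
      induction h1 using Submodule.span_induction with
      | zero => exact zero_mem _
      | add x y h1 h2 h3 h4 => exact add_mem (h3 (hle h1)) (h4 (hle h2))
      | smul a x h1 h2 => exact Submodule.smul_mem _ a (h2 (hle h1))
      | mem x h =>
        obtain ⟨α, hα, β, hβ, hsum, x, hx, y, hy, rfl⟩ := h
        obtain ⟨i, m, rfl⟩ := hσ.exists_eq α hα
        obtain ⟨j, m', rfl⟩ := hσ.exists_eq β hβ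
        rw [← map_add] at hsum
        have h := hσ.injective hsum
        have h2 : P.rootSpanMem ℤ j = -P.rootSpanMem ℤ i :=
          eq_neg_of_add_eq_zero_right (congrArg Prod.fst h)
        have h3 : m' = l - m := eq_sub_of_add_eq' (congrArg Prod.snd h)
        rw [h2, h3] at hy
        exact Submodule.subset_span ⟨i, m, ⟨x, hG.grade_le_ideal hx⟩, hx,
          ⟨y, hG.grade_le_ideal hy⟩, hy, rfl⟩
    · rintro _ ⟨i, m, x, hx, y, hy, rfl⟩
      have := hG.lie_mem_grade hx hy
      rw [← map_add, Prod.mk_add_mk, add_neg_cancel, add_sub_cancel] at this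
      exact this
  closure_eq_top := by
    rw [eq_top_iff, ← hσ.closure_eq_top]
    refine AddSubgroup.closure_mono ?_
    rintro l ⟨i, hi⟩
    obtain ⟨e, he, f, hf, h0, -⟩ := hG.exists_sl2_grade hi
    refine ⟨P.rootSpanMem ℤ i, fun hb => h0 ?_⟩
    have : (⟨e, hG.grade_le_ideal he⟩ : hG.ideal q) ∈ hG.torusGrade q σ (P.rootSpanMem ℤ i) l := he
    rw [hb, Submodule.mem_bot] at this
    exact congrArg Subtype.val this

end Torus

variable (q) in
/-- The ideal attached to a component is a centerless Lie torus. Only here is the discreteness of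
the roots used. -/
theorem isCenterlessLieTorus_ideal : IsCenterlessLieTorus (hG.ideal q) := by
  have := hG.finiteDimensional
  have hC := hG.isComponent_component q
  have hd : @IsDiscrete _ (moduleTopology ℂ (Dual ℂ H)) (hG.component q) := by
    let _ : TopologicalSpace (Dual ℂ H) := moduleTopology ℂ (Dual ℂ H)
    exact hG.discrete.mono fun α hα => hα.1.1
  obtain ⟨ι, M, _, _, P, r, σ, hι, hP, hcr, hirr, hσ⟩ := hC.toIsConnectedRootSet.exists_type hd
  exact ⟨⟨ι, M, _, _, _, _, _, P, _, _, hG.torusGrade q σ, hι, hP, hcr, hirr, inferInstance,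
    inferInstance, isLieTorusGrading hσ⟩, hG.center_ideal q⟩

end IsGRLA

end GenRed

theorem corollary3p2 {G : Type*} [LieRing G] [LieAlgebra ℂ G]
    (form : LinearMap.BilinForm ℂ G) (H : LieSubalgebra ℂ G) (hG : GenRed.IsGRLA form H) :
    ∃ (k : ℕ) (I : Fin k → LieIdeal ℂ (GenRed.CoreModCenter form H)),
      0 < k ∧
      DirectSum.IsInternal (fun i => (I i).toSubmodule) ∧
      ∀ i, GenRed.IsCenterlessLieTorus (I i) := by
  obtain ⟨k, ⟨e⟩⟩ := Finite.exists_equiv_fin (Quotient hG.rootSetoid)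
  refine ⟨k, fun i => hG.ideal (e.symm i), Fin.pos_iff_nonempty.2 (e.nonempty_congr.1 inferInstance),
    ?_, fun i => hG.isCenterlessLieTorus_ideal _⟩
  refine DirectSum.isInternal_submodule_of_iSupIndep_of_iSup_eq_top
    (hG.iSupIndep_ideal.comp e.symm.injective) ?_
  rw [e.symm.iSup_comp (g := fun q => (hG.ideal q).toSubmodule)]
  exact hG.iSup_grade
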